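/- **Conventions.** Write $\mathbb R^+=[0,\infty)$. A ternary algebra $(X,\mu)$ is a set with a map $\mu:X^3\to X$; its intervals are $[a,b]=\{\mu(a,x,b): x\in X\}$, and $\sharp$ denotes cardinality. (M1) means $\mu(a,a,b)=a$, and (M2) means that $\mu$ is invariant under permutations of its arguments. **Coarse median spaces.** A *coarse median space* $(X,d,\mu)$ is a metric space with a ternary operator satisfying (M1), (M2) and: (C1) there is a non-decreasing $\rho:\mathbb R^+\to\mathbb R^+$ with $d(\mu(a,b,c),\mu(a',b,c))\le\rho(d(a,a'))$ for all $a,a',b,c$; (C2) there is $\kappa>0$ with $d\big(\mu(\mu(a,b,c),b,d),\mu(a,b,\mu(c,b,d))\big)\le\kappa$ for all $a,b,c,d$. It has *bounded geometry* if for each $r>0$ the balls of radius $r$ have uniformly bounded finite cardinality. It is *quasi-geodesic* if there are $L,C>0$ such that any $x,y$ admit $\gamma:[0,d(x,y)]\to X$ with $\gamma(0)=x$, $\gamma(d(x,y))=y$ and $L^{-1}|s-t|-C\le d(\gamma(s),\gamma(t))\le L|s-t|+C$ for all $s,t$. A *coarse median morphism* is a map $f$ such that: preimages of bounded sets are bounded;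 $d(f(x),f(x'))\le\rho(d(x,x'))$ for all $x,x'$, for some non-decreasing proper $\rho:\mathbb R^+\to\mathbb R^+$; and $d\big(\mu(f(a),f(b),f(c)),f(\mu(a,b,c))\big)\le C$ for all $a,b,c$, for some constant $C$. Two morphisms $f,g$ are *close* if $\sup_x d(f(x),g(x))<\infty$. The space has *rank at most $n$* if there is $h:\mathbb N\to\mathbb R^+$ such that for every $p$ and every $A\subseteq X$ with $1\le\sharp A\le p$ there are a finite median algebra $\Pi$ of rank at most $n$ (no median cube $\{0,1\}^{k}$ with $k>n$ embeds in $\Pi$) and maps $\pi:A\to\Pi$, $\lambda:\Pi\to X$ with $d\big(\lambda(\mu_\Pi(x,y,z)),\mu(\lambda(x),\lambda(y),\lambda(z))\big)\le h(p)$ for $x,y,z\in\Pi$ and $d(a,\lambda\pi(a))\le h(p)$ for $a\in A$. **Coarse median algebras.** A *coarse median algebra* is a ternary algebra with finite intervals satisfying (M1), (M2) and: there is $K\ge0$ such that for all $a,b,c,d,e$ the interval $[\mu(a,b,\mu(c,d,e)),\,\mu(\mu(a,b,c),\mu(a,b,d),e)]$ has at most $K$ elements. It has *bounded valency* if there is $\phi:\mathbb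 R^+\to\mathbb R^+$ with $\sharp\{y:\sharp[x,y]\le R\}\le\phi(R)$ for all $x$ and $R$. It is *quasi-geodesic* if there are $L,C>0$ such that any $a,b$ are joined by a chain $a=y_0,\dots,y_n=b$ with $\sharp[y_j,y_{j+1}]\le C+1$ for all $j$ and $n\le L\,\sharp[a,b]$. A *coarse median algebra map* is a map $f$ with finite point preimages such that $\sharp[\mu(f(a),f(b),f(c)),f(\mu(a,b,c))]\le C$ for all $a,b,c$, for some constant $C$, and $\sharp[f(a),f(b)]\le\rho(\sharp[a,b])$ for all $a,b$, for some non-decreasing $\rho:\mathbb R^+\to\mathbb R^+$. Two such maps $f,g$ are *equivalent* if $\sharp[f(x),g(x)]\le D$ for all $x$, for some constant $D$. The algebra has *rank at most $n$* if there is a non-decreasing $\varphi:\mathbb R^+\to\mathbb R^+$ such that for all $x_1,\dots,x_{n+1},p,q\in X$, $$\min_i\sharp[p,\mu(x_i,p,q)]\le\varphi\big(\max_{i\ne j}\sharp[p,\mu(x_i,x_j,p)]\big)$$ (the maximum over the empty set being $0$). The *induced metric* is $d_\mu(a,b)=\min\sum_{i=1}^n(\sharp[x_{i-1},x_i]-1)$,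 the minimum being over all finite chains $a=x_0,\dots,x_n=b$. **Theorem.** Consider the category of bounded geometry, quasi-geodesic coarse median spaces, whose morphisms are coarse median morphisms up to closeness, and the category of bounded valency, quasi-geodesic coarse median algebras, whose morphisms are coarse median algebra maps up to equivalence. The assignments $(X,d,\mu)\mapsto(X,\mu)$, $[f]\mapsto[f]$ (forgetting the metric) and $(X,\mu)\mapsto(X,d_\mu,\mu)$, $[f]\mapsto[f]$ (imposing the induced metric) are well-defined functors between these two categories and are quasi-inverse to each other, forming an equivalence of categories. They preserve rank: for every $n\in\mathbb N$, an object of either category has rank at most $n$ if and only if its image in the other category has rank at most $n$. -/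

import Mathlib

open CategoryTheory Filter
open scoped NNReal

universe u

namespace CoarseMedian

noncomputable section

/-! ### Ternary algebras and their intervals -/

section Ternary

variable {X : Type u}

/-- The interval `[a, b]` of a ternary algebra. -/
def interval (μ : X → X → X → X) (a b : X) : Set X := {y | ∃ x, μ a x b = y}

/-- The set `s` is finite and has at most `r` elements. -/
def CardLE {α : Type*} (s : Set α) (r : ℝ≥0) : Prop := s.Finite ∧ (s.ncard : ℝ≥0) ≤ r

/-- Axiom (M1), localisation. -/
def Localised (μ : X → X → X → X) : Prop := ∀ a b, μ a a b = a

/-- Axiom (M2), symmetry (the two transpositions generate the symmetric group). -/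
def Symmetric (μ : X → X → X → X) : Prop := ∀ a b c, μ a b c = μ a c b ∧ μ a b c = μ b a c

/-- Bounded valency of a ternary algebra. -/
def BoundedValency (μ : X → X → X → X) : Prop :=
  ∃ φ : ℝ≥0 → ℝ≥0, ∀ (R : ℝ≥0) (x : X), CardLE {y | CardLE (interval μ x y) R} (φ R)

/-- Quasi-geodesic ternary algebras: points are joined by chains of uniformly small intervals
whose length is linearly bounded by the cardinality of the interval. -/
def QuasiGeodesicAlgebra (μ : X → X → X → X) : Prop :=
  ∃ L C : ℝ≥0, 0 < L ∧ 0 < C ∧ ∀ a b : X, ∃ (n : ℕ) (y : ℕ → X), y 0 = a ∧ y n = b ∧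
    (∀ j < n, CardLE (interval μ (y j) (y (j + 1))) (C + 1)) ∧
    ((interval μ a b).Finite → (n : ℝ≥0) ≤ L * (interval μ a b).ncard)

/-- Coarse median algebras. -/
structure IsCoarseMedianAlgebra (μ : X → X → X → X) : Prop where
  finite : ∀ a b, (interval μ a b).Finite
  localised : Localised μ
  symmetric : Symmetric μ
  five_point : ∃ K : ℝ≥0, ∀ a b c d e,
    CardLE (interval μ (μ a b (μ c d e)) (μ (μ a b c) (μ a b d) e)) K

/-- Rank at most `n` for a coarse median algebra; `∃ i` expresses the bound on the minimum over
`i`, and the supremum is the maximum over the pairs `i ≠ j` (it is `0` if there are none). -/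
def AlgebraRankLE (μ : X → X → X → X) (n : ℕ) : Prop :=
  ∃ φ : ℝ≥0 → ℝ≥0, Monotone φ ∧ ∀ (x : Fin (n + 1) → X) (p q : X), ∃ i,
    ((interval μ p (μ (x i) p q)).ncard : ℝ≥0) ≤
      φ ((Finset.univ.offDiag : Finset (Fin (n + 1) × Fin (n + 1))).sup fun ij =>
        ((interval μ p (μ (x ij.1) (x ij.2) p)).ncard : ℝ≥0))

/-- The total weights of the finite chains of finite intervals from `a` to `b`. -/
def chainWeights (μ : X → X → X → X) (a b : X) : Set ℕ :=
  {s | ∃ (n : ℕ) (x : ℕ → X), x 0 = a ∧ x n = b ∧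
    (∀ i < n, (interval μ (x i) (x (i + 1))).Finite) ∧
    s = ∑ i ∈ Finset.range n, ((interval μ (x i) (x (i + 1))).ncard - 1)}

/-- The induced function `d_μ`, the minimal weight of a chain from `a` to `b`. -/
def inducedDist (μ : X → X → X → X) (a b : X) : ℕ := sInf (chainWeights μ a b)

end Ternary

/-! ### Median algebras, median cubes and rank -/

/-- Median algebras. -/
structure IsMedianAlgebra {P : Type*} (m : P → P → P → P) : Prop where
  localised : Localised m
  symmetric : Symmetric m
  five_point : ∀ a b c d e, m a b (m c d e) = m (m a b c) (m a b d) e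

/-- The median of the median `k`-cube: majority vote in each coordinate. -/
def cubeMedian (k : ℕ) (x y z : Fin k → Bool) : Fin k → Bool :=
  fun i => (x i && y i) || (y i && z i) || (x i && z i)

/-- A median algebra has rank at most `n` if every median cube that embeds in it has dimension
at most `n`. -/
def MedianRankLE {P : Type*} (m : P → P → P → P) (n : ℕ) : Prop :=
  ∀ (k : ℕ) (c : (Fin k → Bool) → P), Function.Injective c →
    (∀ x y z, c (cubeMedian k x y z) = m (c x) (c y) (c z)) → k ≤ n

/-! ### Coarse median spaces -/

/-- Bounded geometry of a metric space. -/
def BoundedGeometry (X : Type u) [MetricSpace X] : Prop :=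
  ∀ r : ℝ, 0 < r → ∃ n : ℕ, ∀ x : X,
    (Metric.closedBall x r).Finite ∧ (Metric.closedBall x r).ncard ≤ n

/-- Quasi-geodesic metric spaces; only the values of `γ` on `[0, d(x, y)]` matter. -/
def QuasiGeodesicSpace (X : Type u) [MetricSpace X] : Prop :=
  ∃ L C : ℝ, 0 < L ∧ 0 < C ∧ ∀ x y : X, ∃ γ : ℝ → X, γ 0 = x ∧ γ (dist x y) = y ∧
    ∀ s ∈ Set.Icc 0 (dist x y), ∀ t ∈ Set.Icc 0 (dist x y),
      L⁻¹ * |s - t| - C ≤ dist (γ s) (γ t) ∧ dist (γ s) (γ t) ≤ L * |s - t| + C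

/-- `(X, d, μ)` is a coarse median space: axioms (M1), (M2), (C1), (C2). -/
structure IsCoarseMedianSpace {X : Type u} [MetricSpace X] (μ : X → X → X → X) : Prop where
  localised : Localised μ
  symmetric : Symmetric μ
  bornologous : ∃ ρ : ℝ≥0 → ℝ≥0, Monotone ρ ∧ ∀ a a' b c,
    nndist (μ a b c) (μ a' b c) ≤ ρ (nndist a a')
  four_point : ∃ κ : ℝ, 0 < κ ∧ ∀ a b c d, dist (μ (μ a b c) b d) (μ a b (μ c b d)) ≤ κ

/-- Rank at most `n` for a coarse median space: the median algebras that approximate the finite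
subsets can be taken to be of rank at most `n`. -/
def SpaceRankLE {X : Type u} [MetricSpace X] (μ : X → X → X → X) (n : ℕ) : Prop :=
  ∃ h : ℕ → ℝ≥0, ∀ (p : ℕ) (A : Finset X), A.Nonempty → A.card ≤ p →
    ∃ (P : Type) (_ : Finite P) (m : P → P → P → P) (proj : A → P) (lam : P → X),
      IsMedianAlgebra m ∧ MedianRankLE m n ∧
      (∀ x y z, dist (lam (m x y z)) (μ (lam x) (lam y) (lam z)) ≤ h p) ∧
      ∀ a : A, dist (a : X) (lam (proj a)) ≤ h p

section SpaceMaps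

variable {X Y Z : Type u} [MetricSpace X] [MetricSpace Y] [MetricSpace Z]

/-- Coarse maps: bornologous with respect to a proper control function, and proper. -/
structure IsCoarseMap (f : X → Y) : Prop where
  bornologous : ∃ ρ : ℝ≥0 → ℝ≥0, Monotone ρ ∧ Tendsto ρ atTop atTop ∧
    ∀ x x', nndist (f x) (f x') ≤ ρ (nndist x x')
  proper : ∀ B : Set Y, Bornology.IsBounded B → Bornology.IsBounded (f ⁻¹' B)

/-- Coarse median morphisms: coarse maps that are quasi-morphisms of the medians. -/
structure IsCoarseMedianMorphism (μX : X → X → X → X) (μY : Y → Y → Y → Y) (f : X → Y) :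
    Prop where
  coarse : IsCoarseMap f
  quasi : ∃ C : ℝ, 0 < C ∧ ∀ a b c, dist (μY (f a) (f b) (f c)) (f (μX a b c)) ≤ C

/-- Closeness of maps. -/
def Close {W : Type u} (f g : W → Y) : Prop := ∃ s : ℝ, ∀ x, dist (f x) (g x) ≤ s

lemma isCoarseMedianMorphism_id (μX : X → X → X → X) : IsCoarseMedianMorphism μX μX id where
  coarse := ⟨⟨id, monotone_id, tendsto_id, fun _ _ => le_rfl⟩, fun _ h => h⟩
  quasi := ⟨1, one_pos, fun a b c => by simp⟩

lemma IsCoarseMedianMorphism.comp {μX : X → X → X → X} {μY : Y → Y → Y → Y}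
    {μZ : Z → Z → Z → Z} {g : Y → Z} {f : X → Y} (hg : IsCoarseMedianMorphism μY μZ g)
    (hf : IsCoarseMedianMorphism μX μY f) : IsCoarseMedianMorphism μX μZ (g ∘ f) := by
  obtain ⟨⟨⟨ρg, mg, tg, bg⟩, pg⟩, Cg, Cg0, qg⟩ := hg
  obtain ⟨⟨⟨ρf, mf, tf, bf⟩, pf⟩, Cf, Cf0, qf⟩ := hf
  refine ⟨⟨⟨ρg ∘ ρf, mg.comp mf, tg.comp tf, fun x x' => (bg _ _).trans (mg (bf _ _))⟩,
    fun B hB => pf _ (pg _ hB)⟩, Cg + ρg (Real.toNNReal Cf), by positivity, fun a b c => ?_⟩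
  refine (dist_triangle _ (g (μY (f a) (f b) (f c))) _).trans (add_le_add (qg _ _ _) ?_)
  have h := (bg (μY (f a) (f b) (f c)) (f (μX a b c))).trans
    (mg (show nndist (μY (f a) (f b) (f c)) (f (μX a b c)) ≤ Real.toNNReal Cf by
      rw [← NNReal.coe_le_coe, coe_nndist, Real.coe_toNNReal _ Cf0.le]; exact qf a b c))
  rw [← NNReal.coe_le_coe, coe_nndist] at h
  exact h

lemma Close.comp {W : Type u} {μY : Y → Y → Y → Y} {μZ : Z → Z → Z → Z} {g g' : Y → Z} {f f' : W → Y}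
    (hg : IsCoarseMedianMorphism μY μZ g) (hgg : Close g g') (hff : Close f f') :
    Close (g ∘ f) (g' ∘ f') := by
  obtain ⟨ρ, m, -, b⟩ := hg.coarse.bornologous
  obtain ⟨s, hs⟩ := hgg
  obtain ⟨t, ht⟩ := hff
  refine ⟨ρ (Real.toNNReal t) + s, fun x => ?_⟩
  refine (dist_triangle _ (g (f' x)) _).trans (add_le_add ?_ (hs _))
  have h := (b (f x) (f' x)).trans (m (show nndist (f x) (f' x) ≤ Real.toNNReal t by
    rw [← NNReal.coe_le_coe, coe_nndist]; exact (ht x).trans (Real.le_coe_toNNReal t)))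
  rw [← NNReal.coe_le_coe, coe_nndist] at h
  exact h

lemma Close.equivalence {W : Type u} : Equivalence (Close : (W → Y) → (W → Y) → Prop) where
  refl f := ⟨0, fun x => by simp⟩
  symm := fun ⟨s, hs⟩ => ⟨s, fun x => by rw [dist_comm]; exact hs x⟩
  trans := fun ⟨s, hs⟩ ⟨t, ht⟩ =>
    ⟨s + t, fun x => (dist_triangle _ _ _).trans (add_le_add (hs x) (ht x))⟩

end SpaceMaps

/-- Coarse median spaces. -/
structure Space : Type (u + 1) where
  carrier : Type u
  [metric : MetricSpace carrier]
  med : carrier → carrier → carrier → carrier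
  isCoarseMedianSpace : IsCoarseMedianSpace med

attribute [instance] Space.metric

namespace Space

/-- Coarse median morphisms up to closeness. -/
instance homSetoid (X Y : Space.{u}) :
    Setoid {f : X.carrier → Y.carrier // IsCoarseMedianMorphism X.med Y.med f} where
  r f g := Close f.1 g.1
  iseqv := ⟨fun _ => Close.equivalence.refl _, fun h => Close.equivalence.symm h,
    fun h h' => Close.equivalence.trans h h'⟩

/-- The category of coarse median spaces: morphisms are closeness classes of coarse median
morphisms, composed as maps. -/
instance : Category.{u} Space.{u} where
  Hom X Y := Quotient (homSetoid X Y)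
  id X := ⟦⟨id, isCoarseMedianMorphism_id X.med⟩⟧
  comp {X Y Z} F G := Quotient.map₂
    (fun (f : {f : X.carrier → Y.carrier // IsCoarseMedianMorphism X.med Y.med f})
      (g : {g : Y.carrier → Z.carrier // IsCoarseMedianMorphism Y.med Z.med g}) =>
      (⟨g.1 ∘ f.1, g.2.comp f.2⟩ :
        {h : X.carrier → Z.carrier // IsCoarseMedianMorphism X.med Z.med h}))
    (fun f f' hf g g' hg =>
      show Close (g.1 ∘ f.1) (g'.1 ∘ f'.1) from Close.comp g.2 hg hf) F G
  id_comp F := by induction F using Quotient.inductionOn; rfl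
  comp_id F := by induction F using Quotient.inductionOn; rfl
  assoc F G H := by
    induction F using Quotient.inductionOn
    induction G using Quotient.inductionOn
    induction H using Quotient.inductionOn
    rfl

/-- Bounded geometry, quasi-geodesic coarse median spaces. -/
def boundedGeometryQuasiGeodesic : ObjectProperty Space.{u} :=
  fun X => BoundedGeometry X.carrier ∧ QuasiGeodesicSpace X.carrier

end Space

/-! ### Coarse median algebras of bounded valency -/

section AlgebraMaps

variable {X Y Z : Type u}

/-- Coarse median algebra maps. -/
structure IsAlgebraMap (μX : X → X → X → X) (μY : Y → Y → Y → Y) (f : X → Y) : Prop where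
  finite_to_one : ∀ y, (f ⁻¹' {y}).Finite
  quasi : ∃ C : ℝ≥0, ∀ a b c, CardLE (interval μY (μY (f a) (f b) (f c)) (f (μX a b c))) C
  controlled : ∃ ρ : ℝ≥0 → ℝ≥0, Monotone ρ ∧ ∀ a b,
    ((interval μY (f a) (f b)).ncard : ℝ≥0) ≤ ρ ((interval μX a b).ncard : ℝ≥0)

/-- Equivalence of coarse median algebra maps. -/
def AlgClose (μY : Y → Y → Y → Y) (f g : X → Y) : Prop :=
  ∃ D : ℝ≥0, ∀ x, CardLE (interval μY (f x) (g x)) D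

lemma CardLE.mono {α : Type*} {s t : Set α} {r q : ℝ≥0} (h : CardLE t r) (hs : s ⊆ t)
    (hr : r ≤ q) : CardLE s q :=
  ⟨h.1.subset hs, le_trans (by exact_mod_cast Set.ncard_le_ncard hs h.1) (h.2.trans hr)⟩

lemma CardLE.biUnion {α β : Type*} {s : Set α} {t : α → Set β} {r q : ℝ≥0} (h : CardLE s r)
    (ht : ∀ a ∈ s, CardLE (t a) q) : CardLE (⋃ a ∈ s, t a) (r * q) := by
  obtain ⟨hfin, hc⟩ := h
  refine ⟨hfin.biUnion fun a ha => (ht a ha).1, ?_⟩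
  have key : ((⋃ a ∈ s, t a).ncard : ℝ≥0) ≤ (s.ncard : ℝ≥0) * q := by
    clear hc
    induction s, hfin using Set.Finite.induction_on with
    | empty => simp
    | @insert a s ha hs ih =>
      rw [Set.biUnion_insert, Set.ncard_insert_of_notMem ha hs]
      have h1 := ih fun b hb => ht b (Set.mem_insert_of_mem _ hb)
      have h2 := (ht a (Set.mem_insert _ _)).2
      have h3 : ((t a ∪ ⋃ x ∈ s, t x).ncard : ℝ≥0) ≤ (t a).ncard + (⋃ x ∈ s, t x).ncard := by
        exact_mod_cast Set.ncard_union_le _ _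
      calc _ ≤ _ := h3
        _ ≤ q + s.ncard * q := add_le_add h2 h1
        _ = _ := by push_cast; ring
  exact key.trans (mul_le_mul_left hc q)

lemma interval_comm {μ : X → X → X → X} (hs : Symmetric μ) (a b : X) :
    interval μ a b = interval μ b a := by
  have h : ∀ x, μ a x b = μ b x a := fun x => by
    rw [(hs a x b).1, (hs a b x).2, (hs b a x).1]
  ext y
  simp only [interval, Set.mem_ofPred_eq, h]

lemma left_mem_interval {μ : X → X → X → X} (hl : Localised μ) (a b : X) :
    a ∈ interval μ a b := ⟨a, hl a b⟩

lemma right_mem_interval {μ : X → X → X → X} (hl : Localised μ) (hs : Symmetric μ) (a b : X) :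
    b ∈ interval μ a b := by
  rw [interval_comm hs]
  exact left_mem_interval hl b a

lemma interval_self {μ : X → X → X → X} (hl : Localised μ) (hs : Symmetric μ) (a : X) :
    interval μ a a = {a} := by
  have h : ∀ x, μ a x a = a := fun x => by rw [(hs a x a).1, hl]
  ext y
  simp only [interval, Set.mem_ofPred_eq, Set.mem_singleton_iff, h]
  exact ⟨fun ⟨_, h⟩ => h.symm, fun h => ⟨a, h.symm⟩⟩

lemma cardLE_interval_self {μ : X → X → X → X} (hl : Localised μ) (hs : Symmetric μ) (a : X) :
    CardLE (interval μ a a) 1 := by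
  rw [interval_self hl hs]
  exact ⟨Set.finite_singleton _, by simp⟩

/-- In a bounded valency coarse median algebra the cardinality of `[μ(x,b,c), μ(x',b,c)]` is
linearly bounded by that of `[x, x']`. -/
lemma exists_cardLE_interval_med {μ : X → X → X → X} (hμ : IsCoarseMedianAlgebra μ)
    (hv : BoundedValency μ) : ∃ M : ℝ≥0, ∀ (x x' b c : X) (R : ℝ≥0),
      CardLE (interval μ x x') R → CardLE (interval μ (μ x b c) (μ x' b c)) (R * M) := by
  obtain ⟨K, hK⟩ := hμ.five_point
  obtain ⟨φ, hφ⟩ := hv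
  have hs := hμ.symmetric
  refine ⟨φ K, fun x x' b c R hR => ?_⟩
  refine (hR.biUnion (t := fun w => {t | CardLE (interval μ (μ b c w) t) K})
    fun w _ => hφ K (μ b c w)).mono ?_ le_rfl
  rintro _ ⟨z, rfl⟩
  simp only [Set.mem_iUnion, Set.mem_ofPred_eq]
  refine ⟨μ x z x', ⟨z, rfl⟩, ?_⟩
  have rot : ∀ y, μ y b c = μ b c y := fun y => by rw [(hs y b c).2, (hs b y c).1]
  have h := hK b c x x' z
  rw [(hs x x' z).1, (hs (μ b c x) (μ b c x') z).1, ← rot x, ← rot x'] at h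
  exact h

/-- A coarse triangle inequality for cardinalities of intervals. -/
lemma exists_cardLE_interval_trans {μ : X → X → X → X} (hμ : IsCoarseMedianAlgebra μ)
    (hv : BoundedValency μ) : ∃ B : ℝ≥0 → ℝ≥0 → ℝ≥0, ∀ (a b c : X) (R S : ℝ≥0),
      CardLE (interval μ a b) R → CardLE (interval μ b c) S →
        CardLE (interval μ a c) (B R S) := by
  obtain ⟨M, hM⟩ := exists_cardLE_interval_med hμ hv
  obtain ⟨φ, hφ⟩ := hv
  have hs := hμ.symmetric
  refine ⟨fun R S => φ (S * M) * φ (R * M), fun a b c R S hR hS => ?_⟩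
  refine ((hφ (S * M) c).biUnion (t := fun w => {t | CardLE (interval μ w t) (R * M)})
    fun w _ => hφ (R * M) w).mono ?_ le_rfl
  rintro _ ⟨x, rfl⟩
  simp only [Set.mem_iUnion, Set.mem_ofPred_eq]
  refine ⟨μ b x c, ?_, ?_⟩
  · have h := hM b c x c S hS
    have hc : μ c x c = c := by rw [(hs c x c).1, hμ.localised]
    rw [hc, interval_comm hs] at h
    exact h
  · rw [interval_comm hs]
    exact hM a b x c R hR

lemma isAlgebraMap_id {μ : X → X → X → X} (hμ : IsCoarseMedianAlgebra μ) :
    IsAlgebraMap μ μ id where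
  finite_to_one y := Set.finite_singleton y
  quasi := ⟨1, fun _ _ _ => cardLE_interval_self hμ.localised hμ.symmetric _⟩
  controlled := ⟨id, monotone_id, fun _ _ => le_rfl⟩

lemma IsAlgebraMap.comp {μX : X → X → X → X} {μY : Y → Y → Y → Y} {μZ : Z → Z → Z → Z}
    (hμ : IsCoarseMedianAlgebra μZ) (hv : BoundedValency μZ) {g : Y → Z} {f : X → Y}
    (hg : IsAlgebraMap μY μZ g) (hf : IsAlgebraMap μX μY f) : IsAlgebraMap μX μZ (g ∘ f) := by
  obtain ⟨B, hB⟩ := exists_cardLE_interval_trans hμ hv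
  obtain ⟨Cg, qg⟩ := hg.quasi
  obtain ⟨Cf, qf⟩ := hf.quasi
  obtain ⟨ρg, mg, bg⟩ := hg.controlled
  obtain ⟨ρf, mf, bf⟩ := hf.controlled
  refine ⟨fun z => ?_, ⟨B Cg (ρg Cf), fun a b c => ?_⟩, ρg ∘ ρf, mg.comp mf,
    fun a b => (bg _ _).trans (mg (bf _ _))⟩
  · rw [Set.preimage_comp]
    exact (hg.finite_to_one z).preimage' fun y _ => hf.finite_to_one y
  · exact hB _ (g (μY (f a) (f b) (f c))) _ _ _ (qg _ _ _)
      ⟨hμ.finite _ _, (bg _ _).trans (mg (qf a b c).2)⟩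

lemma AlgClose.comp {μY : Y → Y → Y → Y} {μZ : Z → Z → Z → Z}
    (hμ : IsCoarseMedianAlgebra μZ) (hv : BoundedValency μZ) {g g' : Y → Z} {f f' : X → Y}
    (hg : IsAlgebraMap μY μZ g) (hgg : AlgClose μZ g g') (hff : AlgClose μY f f') :
    AlgClose μZ (g ∘ f) (g' ∘ f') := by
  obtain ⟨B, hB⟩ := exists_cardLE_interval_trans hμ hv
  obtain ⟨ρg, mg, bg⟩ := hg.controlled
  obtain ⟨D, hD⟩ := hff
  obtain ⟨E, hE⟩ := hgg
  exact ⟨B (ρg D) E, fun x => hB _ (g (f' x)) _ _ _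
    ⟨hμ.finite _ _, (bg _ _).trans (mg (hD x).2)⟩ (hE _)⟩

lemma AlgClose.equivalence {μY : Y → Y → Y → Y} (hμ : IsCoarseMedianAlgebra μY)
    (hv : BoundedValency μY) : Equivalence (AlgClose μY : (X → Y) → (X → Y) → Prop) where
  refl f := ⟨1, fun x => cardLE_interval_self hμ.localised hμ.symmetric _⟩
  symm := fun ⟨s, hs⟩ => ⟨s, fun x => by rw [interval_comm hμ.symmetric]; exact hs x⟩
  trans := fun ⟨s, hs⟩ ⟨t, ht⟩ => by
    obtain ⟨B, hB⟩ := exists_cardLE_interval_trans hμ hv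
    exact ⟨B s t, fun x => hB _ _ _ _ _ (hs x) (ht x)⟩

end AlgebraMaps

/-- Coarse median algebras of bounded valency. -/
structure Algebra : Type (u + 1) where
  carrier : Type u
  med : carrier → carrier → carrier → carrier
  isCoarseMedianAlgebra : IsCoarseMedianAlgebra med
  boundedValency : BoundedValency med

namespace Algebra

/-- Coarse median algebra maps up to equivalence. -/
instance homSetoid (A B : Algebra.{u}) :
    Setoid {f : A.carrier → B.carrier // IsAlgebraMap A.med B.med f} where
  r f g := AlgClose B.med f.1 g.1
  iseqv :=
    have e := AlgClose.equivalence (X := A.carrier) B.isCoarseMedianAlgebra B.boundedValency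
    ⟨fun _ => e.refl _, fun h => e.symm h, fun h h' => e.trans h h'⟩

/-- The category of bounded valency coarse median algebras: morphisms are equivalence classes of
coarse median algebra maps, composed as maps. -/
instance : Category.{u} Algebra.{u} where
  Hom A B := Quotient (homSetoid A B)
  id A := ⟦⟨id, isAlgebraMap_id A.isCoarseMedianAlgebra⟩⟧
  comp {A B C} F G := Quotient.map₂
    (fun (f : {f : A.carrier → B.carrier // IsAlgebraMap A.med B.med f})
      (g : {g : B.carrier → C.carrier // IsAlgebraMap B.med C.med g}) =>
      (⟨g.1 ∘ f.1, g.2.comp C.isCoarseMedianAlgebra C.boundedValency f.2⟩ :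
        {h : A.carrier → C.carrier // IsAlgebraMap A.med C.med h}))
    (fun f f' hf g g' hg => show AlgClose C.med (g.1 ∘ f.1) (g'.1 ∘ f'.1) from
      AlgClose.comp C.isCoarseMedianAlgebra C.boundedValency g.2 hg hf) F G
  id_comp F := by induction F using Quotient.inductionOn; rfl
  comp_id F := by induction F using Quotient.inductionOn; rfl
  assoc F G H := by
    induction F using Quotient.inductionOn
    induction G using Quotient.inductionOn
    induction H using Quotient.inductionOn
    rfl

/-- Quasi-geodesic coarse median algebras (of bounded valency). -/
def quasiGeodesic : ObjectProperty Algebra.{u} := fun A => QuasiGeodesicAlgebra A.med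

end Algebra

/-! ### The induced metric -/

section InducedMetric

variable {X : Type u} {μ : X → X → X → X}

lemma chainWeights_nonempty (hμ : IsCoarseMedianAlgebra μ) (a b : X) :
    (chainWeights μ a b).Nonempty :=
  ⟨_, 1, fun i => if i = 0 then a else b, rfl, rfl, fun _ _ => hμ.finite _ _, rfl⟩

lemma inducedDist_self (a : X) : inducedDist μ a a = 0 :=
  Nat.sInf_eq_zero.2 (Or.inl ⟨0, fun _ => a, rfl, rfl, by simp, by simp⟩)

lemma inducedDist_triangle (hμ : IsCoarseMedianAlgebra μ) (a b c : X) :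
    inducedDist μ a c ≤ inducedDist μ a b + inducedDist μ b c := by
  obtain ⟨n, x, x0, xn, -, hx⟩ := Nat.sInf_mem (chainWeights_nonempty hμ a b)
  obtain ⟨m, y, y0, ym, -, hy⟩ := Nat.sInf_mem (chainWeights_nonempty hμ b c)
  refine Nat.sInf_le ⟨n + m, fun i => if i ≤ n then x i else y (i - n), by simpa using x0, ?_,
    fun _ _ => hμ.finite _ _, ?_⟩
  · rcases Nat.eq_zero_or_pos m with rfl | hm
    · simp [xn, ← ym, y0]
    · have : ¬ n + m ≤ n := by omega
      simp [this, ym]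
  · rw [Finset.sum_range_add]
    unfold inducedDist
    rw [hx, hy]
    congr 1
    · refine Finset.sum_congr rfl fun i hi => ?_
      have hi : i < n := Finset.mem_range.1 hi
      simp [hi.le, Nat.succ_le_of_lt hi]
    · refine Finset.sum_congr rfl fun i _ => ?_
      have h1 : ¬ n + i + 1 ≤ n := by omega
      have h2 : n + i + 1 - n = i + 1 := by omega
      rcases Nat.eq_zero_or_pos i with rfl | hi
      · simp [xn, y0]
      · have h3 : ¬ n + i ≤ n := by omega
        simp [h1, h2, h3]

lemma chainWeights_symm (hs : Symmetric μ) {a b : X} {s : ℕ} (h : s ∈ chainWeights μ a b) :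
    s ∈ chainWeights μ b a := by
  obtain ⟨n, x, x0, xn, hf, rfl⟩ := h
  have key : ∀ i < n, interval μ (x (n - i)) (x (n - (i + 1))) =
      interval μ (x (n - 1 - i)) (x (n - 1 - i + 1)) := fun i hi => by
    rw [interval_comm hs, show n - (i + 1) = n - 1 - i by omega,
      show n - i = n - 1 - i + 1 by omega]
  refine ⟨n, fun i => x (n - i), by simpa using xn, by simpa using x0, fun i hi => ?_, ?_⟩
  · rw [key i hi]
    exact hf _ (by omega)
  · rw [← Finset.sum_range_reflect]
    exact Finset.sum_congr rfl fun i hi => by rw [key i (Finset.mem_range.1 hi)]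

lemma inducedDist_comm (hs : Symmetric μ) (a b : X) : inducedDist μ a b = inducedDist μ b a := by
  unfold inducedDist
  congr 1
  exact Set.ext fun _ => ⟨chainWeights_symm hs, chainWeights_symm hs⟩

lemma eq_of_inducedDist_eq_zero (hμ : IsCoarseMedianAlgebra μ) {a b : X}
    (h : inducedDist μ a b = 0) : a = b := by
  obtain ⟨n, x, rfl, rfl, -, hx⟩ := Nat.sInf_mem (chainWeights_nonempty hμ a b)
  have hx : 0 = ∑ i ∈ Finset.range n, ((interval μ (x i) (x (i + 1))).ncard - 1) :=
    h.symm.trans hx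
  have hz : ∀ i < n, x i = x (i + 1) := fun i hi => by
    have h1 := Finset.sum_eq_zero_iff.1 hx.symm i (Finset.mem_range.2 hi)
    exact (Set.ncard_le_one (hμ.finite _ _)).1 (by omega) _
      (left_mem_interval hμ.localised _ _) _
      (right_mem_interval hμ.localised hμ.symmetric _ _)
  have : ∀ i ≤ n, x 0 = x i := fun i => by
    induction i with
    | zero => simp
    | succ i ih => exact fun hi => (ih (by omega)).trans (hz i (by omega))
  exact this n le_rfl

/-- The underlying set of a coarse median algebra, regarded as a metric space with the induced
metric. -/
def Algebra.Metrized (A : Algebra.{u}) : Type u := A.carrier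

instance (A : Algebra.{u}) : MetricSpace A.Metrized where
  dist a b := (inducedDist A.med a b : ℝ)
  dist_self a := by exact_mod_cast inducedDist_self (μ := A.med) a
  dist_comm a b := by exact_mod_cast inducedDist_comm A.isCoarseMedianAlgebra.symmetric a b
  dist_triangle a b c := by exact_mod_cast inducedDist_triangle A.isCoarseMedianAlgebra a b c
  eq_of_dist_eq_zero h := eq_of_inducedDist_eq_zero A.isCoarseMedianAlgebra (by exact_mod_cast h)

/-- The median of a coarse median algebra as an operator on its metrized version. -/
def Algebra.metrizedMed (A : Algebra.{u}) :
    A.Metrized → A.Metrized → A.Metrized → A.Metrized := A.med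

end InducedMetric

/-! ### The two functors -/

/-- The category of bounded geometry, quasi-geodesic coarse median spaces. -/
abbrev QGSpace : Type (u + 1) := Space.boundedGeometryQuasiGeodesic.{u}.FullSubcategory

/-- The category of bounded valency, quasi-geodesic coarse median algebras. -/
abbrev QGAlgebra : Type (u + 1) := Algebra.quasiGeodesic.{u}.FullSubcategory

/-- Forgetting the metric turns bounded geometry, quasi-geodesic coarse median spaces into bounded
valency, quasi-geodesic coarse median algebras, coarse median morphisms into coarse median algebra
maps, and close morphisms into equivalent maps. -/
structure ForgetfulWellDefined : Prop where
  isAlgebra : ∀ X : QGSpace.{u}, IsCoarseMedianAlgebra X.obj.med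
  boundedValency : ∀ X : QGSpace.{u}, BoundedValency X.obj.med
  quasiGeodesic : ∀ X : QGSpace.{u}, QuasiGeodesicAlgebra X.obj.med
  map : ∀ (X Y : QGSpace.{u}) (f : X.obj.carrier → Y.obj.carrier),
    IsCoarseMedianMorphism X.obj.med Y.obj.med f → IsAlgebraMap X.obj.med Y.obj.med f
  close : ∀ (X Y : QGSpace.{u}) (f g : X.obj.carrier → Y.obj.carrier),
    IsCoarseMedianMorphism X.obj.med Y.obj.med f → IsCoarseMedianMorphism X.obj.med Y.obj.med g →
    Close f g → AlgClose Y.obj.med f g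

/-- The forgetful functor `(X, d, μ) ↦ (X, μ)`, `[f] ↦ [f]`. -/
def forgetfulFunctor (h : ForgetfulWellDefined.{u}) : QGSpace.{u} ⥤ QGAlgebra.{u} where
  obj X := ⟨⟨X.obj.carrier, X.obj.med, h.isAlgebra X, h.boundedValency X⟩, h.quasiGeodesic X⟩
  map {X Y} F := ObjectProperty.homMk (Quotient.map
    (fun (f : {f : X.obj.carrier → Y.obj.carrier //
        IsCoarseMedianMorphism X.obj.med Y.obj.med f}) =>
      (⟨f.1, h.map X Y f.1 f.2⟩ :
        {f : X.obj.carrier → Y.obj.carrier // IsAlgebraMap X.obj.med Y.obj.med f}))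
    (fun f g hfg => h.close X Y f.1 g.1 f.2 g.2 hfg) F.hom)
  map_id X := rfl
  map_comp {X Y Z} F G := by
    obtain ⟨F⟩ := F
    obtain ⟨G⟩ := G
    induction F using Quotient.inductionOn
    induction G using Quotient.inductionOn
    rfl

/-- The induced metric turns bounded valency, quasi-geodesic coarse median algebras into bounded
geometry, quasi-geodesic coarse median spaces, coarse median algebra maps into coarse median
morphisms, and equivalent maps into close morphisms. -/
structure InducedMetricWellDefined : Prop where
  isSpace : ∀ A : QGAlgebra.{u}, IsCoarseMedianSpace A.obj.metrizedMed
  boundedGeometry : ∀ A : QGAlgebra.{u}, BoundedGeometry A.obj.Metrized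
  quasiGeodesic : ∀ A : QGAlgebra.{u}, QuasiGeodesicSpace A.obj.Metrized
  map : ∀ (A B : QGAlgebra.{u}) (f : A.obj.Metrized → B.obj.Metrized),
    IsAlgebraMap A.obj.med B.obj.med f →
    IsCoarseMedianMorphism A.obj.metrizedMed B.obj.metrizedMed f
  close : ∀ (A B : QGAlgebra.{u}) (f g : A.obj.Metrized → B.obj.Metrized),
    IsAlgebraMap A.obj.med B.obj.med f → IsAlgebraMap A.obj.med B.obj.med g →
    AlgClose B.obj.med f g → Close f g

/-- The induced metric functor `(X, μ) ↦ (X, d_μ, μ)`, `[f] ↦ [f]`. -/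
def inducedMetricFunctor (h : InducedMetricWellDefined.{u}) : QGAlgebra.{u} ⥤ QGSpace.{u} where
  obj A := ⟨⟨A.obj.Metrized, A.obj.metrizedMed, h.isSpace A⟩,
    h.boundedGeometry A, h.quasiGeodesic A⟩
  map {A B} F := ObjectProperty.homMk (Quotient.map
    (fun (f : {f : A.obj.carrier → B.obj.carrier // IsAlgebraMap A.obj.med B.obj.med f}) =>
      (⟨f.1, h.map A B f.1 f.2⟩ : {f : A.obj.Metrized → B.obj.Metrized //
        IsCoarseMedianMorphism A.obj.metrizedMed B.obj.metrizedMed f}))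
    (fun f g hfg => h.close A B f.1 g.1 f.2 g.2 hfg) F.hom)
  map_id A := rfl
  map_comp {A B C} F G := by
    obtain ⟨F⟩ := F
    obtain ⟨G⟩ := G
    induction F using Quotient.inductionOn
    induction G using Quotient.inductionOn
    rfl

end

end CoarseMedian

universe v

namespace CoarseMedian

/-! ### Median algebras: the four-point condition implies the five-point condition -/

section FourPoint

variable {P : Type u} {m : P → P → P → P}

/-! In a bounded geometry, quasi-geodesic coarse median space, distance and interval cardinality
control each other. If `a` and `b` are close, every `μ a x b` is close to `μ a x a = a`, so `[a, b]`
is small (`exists_cardLE_interval`). Conversely, the projection `y ↦ μ a y b` carries a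
quasi-geodesic from `a` to `b` to a chain of bounded steps inside `[a, b]`, so the distance is at
most linear in the cardinality (`exists_dist_le_ncard`). For an algebra, `d_μ` is at most the
cardinality of the interval by definition, and bounded valency bounds the cardinality in terms of
`d_μ` (`exists_cardLE_of_inducedDist`). Most axioms and conditions on maps translate through these
estimates. They also make the identity a coarse equivalence between a space and its remetrization,
which gives the unit; the counit is the identity.

Two points need more. The five-point condition must be derived from the four-point one. Families of
points modulo bounded distance form an algebra in which the four-point condition is exact, and there
it implies the five-point condition by betweenness arguments; the universal family of quintuples
then yields a uniform constant.

For rank, both definitions are compared with `CoarseRankLE`. If it fails while approximations of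
rank at most `n` exist, a sequence of bad configurations is studied in the product of the
approximating algebras, where the join of the pairwise meets absorbs the errors. If it holds, the
quotient along an ultrafilter has rank at most `n`, its finitely generated subalgebras are finite,
and lifting one of them back to the space gives the approximations. -/

lemma Symmetric.swap_right (hs : Symmetric m) (a b c : P) : m a b c = m a c b := (hs a b c).1

lemma Symmetric.swap_left (hs : Symmetric m) (a b c : P) : m a b c = m b a c := (hs a b c).2

lemma Symmetric.rotate (hs : Symmetric m) (a b c : P) : m a b c = m b c a := by
  rw [hs.swap_left, hs.swap_right]

lemma Symmetric.reverse (hs : Symmetric m) (a b c : P) : m a b c = m c b a := by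
  rw [hs.rotate, hs.swap_left]

/-- A symmetric localised ternary operation with the associativity `((a b c) b d) = (a b (c b d))`. -/
structure IsFourPointMedian (m : P → P → P → P) : Prop where
  localised : Localised m
  symmetric : Symmetric m
  four_point : ∀ a b c d, m (m a b c) b d = m a b (m c b d)

/-- The point `y` lies between `x` and `z`. -/
def Btw (m : P → P → P → P) (x y z : P) : Prop := m x y z = y

variable {a b c d e u x y z : P}

namespace Btw

lemma symm (h : IsFourPointMedian m) (hb : Btw m x y z) : Btw m z y x := by
  unfold Btw at *
  rwa [h.symmetric.reverse]

lemma trans (h : IsFourPointMedian m) (h1 : Btw m a y x) (h2 : Btw m a x b) : Btw m a y b := by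
  have hs := h.symmetric
  unfold Btw at *
  calc m a y b = m (m y a x) a b := by rw [hs.swap_left y a x, h1, hs.swap_left]
    _ = m y a (m x a b) := h.four_point ..
    _ = y := by rw [hs.swap_left x a b, h2, hs.swap_left, h1]

lemma trans_right (h : IsFourPointMedian m) (h1 : Btw m a y x) (h2 : Btw m a x b) :
    Btw m y x b := by
  have hs := h.symmetric
  unfold Btw at *
  calc m y x b = m (m y x a) x b := by rw [hs.reverse y x a, hs.swap_right a x y, h1]
    _ = m y x (m a x b) := h.four_point ..
    _ = x := by rw [h2, hs.rotate, h.localised]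

lemma med (h : IsFourPointMedian m) (a b c : P) : Btw m a (m a b c) b := by
  have hs := h.symmetric
  unfold Btw
  calc m a (m a b c) b = m (m c a b) a b := by rw [hs.rotate c a b, hs.swap_left]
    _ = m c a (m b a b) := h.four_point ..
    _ = m a b c := by rw [hs.swap_right b a b, h.localised, hs.rotate]

lemma med' (h : IsFourPointMedian m) (a b c : P) : Btw m a (m a b c) c := by
  rw [h.symmetric.swap_right]; exact med h a c b

lemma med'' (h : IsFourPointMedian m) (a b c : P) : Btw m b (m a b c) c := by
  rw [h.symmetric.rotate]; exact med h b c a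

/-- In the order based at `a`, the median `m a b c` is the meet of `b` and `c`. -/
lemma le_med (h : IsFourPointMedian m) (h1 : Btw m a z b) (h2 : Btw m a z c) :
    Btw m a z (m a b c) := by
  have hs := h.symmetric
  unfold Btw at *
  calc m a z (m a b c) = m z a (m b a c) := by rw [hs.swap_left, hs.swap_left b]
    _ = m (m z a b) a c := (h.four_point ..).symm
    _ = z := by rw [hs.swap_left z, h1, hs.swap_left, h2]

lemma antisymm (h : IsFourPointMedian m) (h1 : Btw m x y z) (h2 : Btw m y x z) : x = y := by
  unfold Btw at *
  rw [← h1, h.symmetric.swap_left, h2]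

lemma eq_med (h : IsFourPointMedian m) (h1 : Btw m a z b) (h2 : Btw m b z c) (h3 : Btw m a z c) :
    z = m a b c := by
  have ha : Btw m a z (m a b c) := le_med h h1 h3
  have hb : Btw m b z (m a b c) := by
    have := le_med h (h1.symm h) h2
    rwa [h.symmetric.swap_left b a c] at this
  exact antisymm h (trans_right h ha (med h a b c)) ((hb.symm h))

/-- `m a b u` is the gate of `u` in `[a, b]`. Project `u` to `[x, a]` and `[x, b]`, then to the
interval between the two images. The result lies in all three intervals spanned by `a`, `b`, `u`, so
it is their median by `eq_med`. -/
lemma gate (h : IsFourPointMedian m) (hx : Btw m a x b) (u : P) : Btw m x (m a b u) u := by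
  have hup : Btw m u (m x u a) x := (med h x u a).symm h
  have huq : Btw m u (m x u b) x := (med h x u b).symm h
  have hpa : Btw m u (m x u a) a := med'' h x u a
  have hqb : Btw m u (m x u b) b := med'' h x u b
  set p := m x u a with hp
  set q := m x u b with hq
  have hvp : Btw m u (m p u q) p := (med h p u q).symm h
  have hvq : Btw m u (m p u q) q := med'' h p u q
  have hpq : Btw m p (m p u q) q := med' h p u q
  set v := m p u q with hv
  have hap : Btw m a p x := (med' h x u a).symm h
  have hbq : Btw m b q x := (med' h x u b).symm h
  have hapb : Btw m a p b := trans h hap hx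
  have hpxb : Btw m p x b := trans_right h hap hx
  have hbqp : Btw m b q p := trans h hbq (hpxb.symm h)
  have hpvb : Btw m p v b := trans h hpq (hbqp.symm h)
  have hbva : Btw m b v a := trans h (hpvb.symm h) (hapb.symm h)
  have : v = m a b u := eq_med h (hbva.symm h) ((trans h hvq hqb).symm h)
    ((trans h hvp hpa).symm h)
  rw [← this]
  exact (trans h hvp hup).symm h

/-- The gate of `u` in `[a, b]` lies between `u` and each of `x` and `y`, hence between `u` and `m u
x y = u`; so `u` is its own gate. -/
lemma convex (h : IsFourPointMedian m) (hx : Btw m a x b) (hy : Btw m a y b)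
    (hu : Btw m x u y) : Btw m a u b := by
  have h1 := le_med h ((gate h hx u).symm h) ((gate h hy u).symm h)
  have h2 : m u x y = u := by rw [h.symmetric.swap_left]; exact hu
  rw [h2] at h1
  have h3 : m a b u = u := by
    unfold Btw at h1
    rw [← h1, h.symmetric.swap_right, h.localised]
  have h4 := med h a b u
  rwa [h3] at h4

/-- Let `u` be the projection of `x'` to `[c', d']`. Passing through the gates `c'` and `d'` puts
`u` between `x'` and both `c` and `d`, hence between `x'` and the gate of `x'` in `[c, d]`, hence
between `x'` and `x`. But `x'` is the gate of `x` in `[a, b]`, so it lies between `u` and `x`, which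
forces `u = x'`. -/
lemma proj (h : IsFourPointMedian m) (a b : P) (hx : Btw m c x d) :
    Btw m (m a b c) (m a b x) (m a b d) := by
  have hc := med h a b c
  have hd := med h a b d
  have hm := med h a b x
  have gc := gate h hm c
  have gd := gate h hm d
  have cu := med h (m a b c) (m a b x) (m a b d)
  have du := med'' h (m a b c) (m a b x) (m a b d)
  set c' := m a b c
  set d' := m a b d
  set x' := m a b x
  set u := m c' x' d'
  have hu : Btw m a u b := convex h hc hm cu
  have gu : Btw m u x' x := gate h hu x
  have h1 : Btw m x' u c := trans h (cu.symm h) gc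
  have h2 : Btw m x' u d := trans h du gd
  have h3 : Btw m x' u (m x' c d) := le_med h h1 h2
  have h4 : Btw m x (m x' c d) x' := by
    have := gate h hx x'
    rwa [← h.symmetric.rotate] at this
  have h5 : Btw m x' u x := trans h h3 (h4.symm h)
  have h7 : Btw m c' u d' := med' h c' x' d'
  rwa [antisymm h gu h5] at h7

lemma proj_right (h : IsFourPointMedian m) (a b : P) (hx : Btw m c x d) :
    Btw m (m a b c) (m a b x) d := by
  have h1 := proj h a b hx
  have h2 := gate h (med h a b c) d
  exact trans h h1 h2

end Btw

/-- The four-point condition implies the five-point condition. -/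
theorem IsFourPointMedian.isMedianAlgebra (h : IsFourPointMedian m) : IsMedianAlgebra m where
  localised := h.localised
  symmetric := h.symmetric
  -- The left side lies between each two of the three points on the right, so it is their median.
  five_point a b c d e :=
    Btw.eq_med h (Btw.proj h a b (Btw.med h c d e)) (Btw.proj_right h a b (Btw.med'' h c d e))
      (Btw.proj_right h a b (Btw.med' h c d e))

end FourPoint

/-! ### Homomorphisms to the two-point median algebra -/

section Separation

variable {P : Type u} {m : P → P → P → P}

/-- The median of `Bool`. -/
def boolMaj (x y z : Bool) : Bool := (x && y) || (y && z) || (x && z)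

/-- Median homomorphisms to the two-point median algebra. -/
def IsBoolHom (m : P → P → P → P) (f : P → Bool) : Prop :=
  ∀ x y z, f (m x y z) = boolMaj (f x) (f y) (f z)

namespace IsMedianAlgebra

/-- The interval between `a` and `b` consisting of the fixed points of the projection. -/
abbrev Between (_ : IsMedianAlgebra m) (a b : P) : Type u := {x // m a x b = x}

lemma four_point (h : IsMedianAlgebra m) (a b c d : P) :
    m (m a b c) b d = m a b (m c b d) := by
  have := h.five_point a b c b d
  rw [h.symmetric.rotate a b b, h.localised] at this
  exact this.symm

lemma isFourPointMedian (h : IsMedianAlgebra m) : IsFourPointMedian m :=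
  ⟨h.localised, h.symmetric, h.four_point⟩

lemma med_mem (h : IsMedianAlgebra m) (a b : P) {x y : P} (z : P) (hx : m a x b = x)
    (hy : m a y b = y) : m a (m x y z) b = m x y z := by
  exact Btw.convex h.isFourPointMedian hx hy (Btw.med h.isFourPointMedian x y z)

/-- The five-point condition projects two of the three arguments; a second use, with idempotence,
projects the third. -/
lemma proj_med (h : IsMedianAlgebra m) (a b x y z : P) :
    m a (m x y z) b = m (m a x b) (m a y b) (m a z b) := by
  have hs := h.symmetric
  have key : ∀ x, m a b (m a b x) = m a b x := fun x => by
    rw [hs.swap_right]; exact Btw.med h.isFourPointMedian a b x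
  have h1 : m a b (m x y z) = m (m a b x) (m a b y) z := h.five_point a b x y z
  have h2 := h.five_point a b z (m a b y) (m a b x)
  rw [key, hs.reverse z, ← h1, key, hs.reverse (m a b z)] at h2
  rw [hs.swap_right a _ b, hs.swap_right a x, hs.swap_right a y, hs.swap_right a z, h2]

/-- The interval between `a` and `b` as a distributive lattice with least element `a` and greatest
element `b`. -/
@[reducible] def betweenLattice (h : IsMedianAlgebra m) (a b : P) :
    DistribLattice (h.Between a b) :=
  have hs := h.symmetric
  have hl := h.localised
  have assoc : ∀ c x y z : P, m c (m c x y) z = m c x (m c y z) := fun c x y z => by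
    have := h.four_point x c y z
    rw [hs.swap_left c x y, hs.swap_left c (m x c y), this, hs.swap_left x c, hs.swap_left y c]
  have absorb : ∀ c d x y : P, m c x d = x → m c x (m d x y) = x := fun c d x y hx => by
    have := h.five_point c x d x y
    rw [this, hx, hs.rotate c x x, hl, hl]
  -- Join is the median with `b`, meet the median with `a`.
  { __ := @Lattice.mk' (h.Between a b)
      ⟨fun x y => ⟨m b x y, by rw [hs.rotate b]; exact h.med_mem a b b x.2 y.2⟩⟩
      ⟨fun x y => ⟨m a x y, by rw [hs.rotate a x.1]; exact h.med_mem a b a x.2 y.2⟩⟩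
      (fun x y => Subtype.ext (hs.swap_right ..))
      (fun x y z => Subtype.ext (assoc b ..))
      (fun x y => Subtype.ext (hs.swap_right ..))
      (fun x y z => Subtype.ext (assoc a ..))
      (fun x y => Subtype.ext (absorb b a _ _ (by rw [hs.reverse]; exact x.2)))
      (fun x y => Subtype.ext (absorb a b _ _ x.2))
    le_sup_inf := fun x y z => le_of_eq <| Subtype.ext <| by
      change m a (m b x y) (m b x z) = m b x (m a y z)
      have := h.five_point b x y z a
      rw [hs.rotate a y z, this, hs.rotate a] }

/-- Median homomorphisms to `Bool` separate the points of a median algebra. -/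
theorem exists_isBoolHom (h : IsMedianAlgebra m) {a b : P} (hab : a ≠ b) :
    ∃ f : P → Bool, IsBoolHom m f ∧ f a = false ∧ f b = true := by
  classical
  let _ := h.betweenLattice a b
  have hs := h.symmetric
  have hl := h.localised
  have bm : m a b b = b := by rw [hs.rotate, hl]
  let ea : h.Between a b := ⟨a, hl a b⟩
  let eb : h.Between a b := ⟨b, bm⟩
  have hle : ∀ x y : h.Between a b, x ≤ y ↔ m a x.1 y.1 = x.1 := fun x y => by
    rw [← inf_eq_left, Subtype.ext_iff]; rfl
  have hd : Disjoint ((Order.PFilter.principal eb : Order.PFilter (h.Between a b)) : Set _)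
      ((Order.Ideal.principal ea : Order.Ideal (h.Between a b)) : Set (h.Between a b)) := by
    rw [Set.disjoint_left]
    intro x hx hx'
    have h1 : eb ≤ x := hx
    have h2 : x ≤ ea := hx'
    have h3 := (hle _ _).1 (h1.trans h2)
    simp only [ea, eb] at h3
    rw [hs.swap_right, hl] at h3
    exact hab h3
  -- `J` contains `a` and misses `b`. The homomorphism is the indicator of its complement, composed
  -- with the projection to `[a, b]`.
  obtain ⟨J, hJ, hI, hF⟩ := DistribLattice.prime_ideal_of_disjoint_filter_ideal hd
  have pmem : ∀ x, m a (m a x b) b = m a x b := fun x =>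
    Btw.med' h.isFourPointMedian a x b
  let pr : P → h.Between a b := fun x => ⟨m a x b, pmem x⟩
  refine ⟨fun x => decide (pr x ∉ J), fun x y z => ?_, ?_, ?_⟩
  · have hmed : ∀ x y z, pr (m x y z) = ⟨m (pr x).1 (pr y).1 (pr z).1,
        h.med_mem a b _ (pr x).2 (pr y).2⟩ := fun x y z => Subtype.ext (h.proj_med a b x y z)
    -- A median lies between the meet and the join of any two of its arguments, so the majority
    -- decides its membership in `J`.
    have key : ∀ x y z : P, pr x ⊓ pr y ≤ pr (m x y z) ∧ pr (m x y z) ≤ pr x ⊔ pr y := by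
      intro x y z
      rw [hle, hle, hmed]
      generalize pr x = x
      generalize pr y = y
      generalize hz : pr z = z'
      constructor
      · change m a (m a x.1 y.1) (m x.1 y.1 z'.1) = m a x.1 y.1
        have := h.five_point x.1 y.1 a z'.1 a
        rw [hs.swap_right a z'.1 a, hl, ← hs.rotate a x.1 y.1] at this
        rw [hs.rotate a (m a x.1 y.1)]
        exact this.symm
      · change m a (m x.1 y.1 z'.1) (m b x.1 y.1) = m x.1 y.1 z'.1
        have := h.five_point x.1 y.1 z'.1 b a
        rw [hs.reverse z'.1 b a, hs.swap_right a b, z'.2] at this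
        rw [hs.rotate, hs.rotate b, ← this]
    have low : ∀ x y z, pr x ∈ J → pr y ∈ J → pr (m x y z) ∈ J := fun x y z hx hy =>
      J.lower (key x y z).2 (J.sup_mem hx hy)
    have high : ∀ x y z, pr x ∉ J → pr y ∉ J → pr (m x y z) ∉ J := fun x y z hx hy hm =>
      (hJ.mem_or_mem (J.lower (key x y z).1 hm)).elim hx hy
    have l1 := low x y z
    have l2 := low y z x
    have l3 := low x z y
    have h1 := high x y z
    have h2 := high y z x
    have h3 := high x z y
    rw [← hs.rotate x y z] at l2 h2
    rw [← hs.swap_right x y z] at l3 h3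
    by_cases hx : pr x ∈ J <;> by_cases hy : pr y ∈ J <;> by_cases hz : pr z ∈ J <;>
      simp_all [boolMaj]
  · have : pr a = ea := Subtype.ext (hl a b)
    simp only [this, decide_eq_false_iff_not, not_not]
    exact hI (Order.Ideal.mem_principal_self)
  · have : pr b = eb := Subtype.ext bm
    simp only [this, decide_eq_true_eq]
    exact Set.disjoint_left.1 hF (show eb ≤ eb from le_rfl)

end IsMedianAlgebra

end Separation

/-! ### Finitely generated median algebras -/

section FiniteMedian

variable {P : Type u} {m : P → P → P → P}

lemma IsBoolHom.not {f : P → Bool} (hf : IsBoolHom m f) : IsBoolHom m fun x => !f x := fun x y z => by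
  simp only [hf x y z]
  cases f x <;> cases f y <;> cases f z <;> rfl

namespace IsMedianAlgebra

lemma eq_of_isBoolHom (h : IsMedianAlgebra m) {x y : P}
    (H : ∀ f, IsBoolHom m f → f x = f y) : x = y := by
  by_contra hxy
  obtain ⟨f, hf, h1, h2⟩ := h.exists_isBoolHom hxy
  have := H f hf
  simp [h1, h2] at this

/-- A homomorphism with `f p = f q` is constant on `[p, q]`, and one with the values swapped can be
negated. -/
lemma eq_of_isBoolHom_of_between (h : IsMedianAlgebra m) {p q x y : P} (hx : m p x q = x)
    (hy : m p y q = y)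
    (H : ∀ f, IsBoolHom m f → f p = false → f q = true → f x = f y) : x = y := by
  refine h.eq_of_isBoolHom fun f hf => ?_
  have h1 := hf p x q
  have h2 := hf p y q
  rw [hx] at h1
  rw [hy] at h2
  cases hp : f p <;> cases hq : f q
  · simp_all [boolMaj]
  · exact H f hf hp hq
  · have := H _ hf.not (by simp [hp]) (by simp [hq])
    simpa using this
  · simp_all [boolMaj]

/-- A finitely generated median algebra is finite. -/
theorem finite_of_generated (h : IsMedianAlgebra m) {ι : Type*} [Finite ι] (a : ι → P)
    (hgen : ∀ s : Set P, (∀ i, a i ∈ s) → (∀ x ∈ s, ∀ y ∈ s, ∀ z ∈ s, m x y z ∈ s) →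
      s = Set.univ) : Finite P := by
  classical
  -- A homomorphism is determined by its pattern on the generators, so one choice per pattern
  -- captures them all; `false` fills in for patterns that do not extend.
  let Φ : P → (ι → Bool) → Bool := fun x ε =>
    if hε : ∃ f, IsBoolHom m f ∧ f ∘ a = ε then hε.choose x else false
  refine Finite.of_injective Φ fun x y hxy => h.eq_of_isBoolHom fun f hf => ?_
  have hε : ∃ g, IsBoolHom m g ∧ g ∘ a = f ∘ a := ⟨f, hf, rfl⟩
  have hΦ : ∀ x, Φ x (f ∘ a) = hε.choose x := fun x => dif_pos hε
  obtain ⟨hg, hga⟩ := hε.choose_spec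
  have heq : {x | hε.choose x = f x} = Set.univ := by
    refine hgen _ (fun i => congrFun hga i) fun x hx y hy z hz => ?_
    simp only [Set.mem_ofPred_eq] at *
    rw [hg, hf, hx, hy, hz]
  have hall : ∀ x, hε.choose x = f x := fun x => (Set.eq_univ_iff_forall.1 heq) x
  rw [← hall, ← hall, ← hΦ, ← hΦ, hxy]

end IsMedianAlgebra

/-! ### Rank of median algebras -/

/-- The iterated join in the lattice `[p, q]`. -/
def medJoin (m : P → P → P → P) (p q : P) (l : List P) : P := l.foldr (fun z w => m z w q) p

lemma map_medJoin {Q : Type*} {m' : Q → Q → Q → Q} {f : P → Q}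
    (hf : ∀ x y z, f (m x y z) = m' (f x) (f y) (f z)) (p q : P) (l : List P) :
    f (medJoin m p q l) = l.foldr (fun z w => m' (f z) w (f q)) (f p) := by
  induction l with
  | nil => rfl
  | cons z l ih => 
    change f (m z (medJoin m p q l) q) = _
    rw [hf, ih]
    rfl

lemma IsBoolHom.medJoin {f : P → Bool} (hf : IsBoolHom m f) {p q : P} (hp : f p = false)
    (hq : f q = true) (l : List P) : f (medJoin m p q l) = l.any f := by
  induction l with
  | nil => exact hp
  | cons z l ih =>
    change f (m z (CoarseMedian.medJoin m p q l) q) = _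
    rw [hf, ih, hq, List.any_cons]
    cases f z <;> cases l.any f <;> rfl

namespace IsMedianAlgebra

lemma med_right (h : IsMedianAlgebra m) (p q : P) : m p q q = q := by
  rw [h.symmetric.rotate, h.localised]

lemma medJoin_mem (h : IsMedianAlgebra m) {p q : P} {l : List P} (hl : ∀ z ∈ l, m p z q = z) :
    m p (medJoin m p q l) q = medJoin m p q l := by
  induction l with
  | nil => exact h.localised p q
  | cons z l ih =>
    exact h.med_mem p q q (hl z (by simp)) (ih fun w hw => hl w (by simp [hw]))

/-- Nontrivial pairwise disjoint elements of an interval span a median cube. -/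
theorem exists_eq_of_medianRankLE (h : IsMedianAlgebra m) {n : ℕ} (hr : MedianRankLE m n)
    (z : Fin (n + 1) → P) (p q : P) (hz : ∀ i, m p (z i) q = z i)
    (hd : ∀ i j, i ≠ j → m (z i) (z j) p = p) : ∃ i, z i = p := by
  by_contra! hne
  let c : (Fin (n + 1) → Bool) → P := fun S =>
    medJoin m p q (((List.finRange (n + 1)).filter (S ·)).map z)
  have cmem : ∀ S, m p (c S) q = c S := fun S => h.medJoin_mem fun w hw => by
    obtain ⟨i, -, rfl⟩ := List.mem_map.1 hw
    exact hz i
  -- Disjointness lets `f` be true on at most one `z i`, so `f` reads off coordinate `i` of the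
  -- cube. As `z i ≠ p`, every coordinate is read by some `f`, which makes `c` injective.
  have hc : ∀ f, IsBoolHom m f → f p = false → f q = true → ∀ i, f (z i) = true → ∀ S,
      f (c S) = S i := fun f hf hp hq i hi S => by
    rw [hf.medJoin hp hq, Bool.eq_iff_iff]
    simp only [List.any_eq_true, List.mem_map, List.mem_filter, List.mem_finRange, true_and]
    constructor
    · rintro ⟨_, ⟨j, hj, rfl⟩, hfj⟩
      by_cases hij : i = j
      · exact hij ▸ hj
      · have := hf (z i) (z j) p
        rw [hd i j hij, hp, hi, hfj] at this
        simp [boolMaj] at this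
    · exact fun hS => ⟨_, ⟨i, hS, rfl⟩, hi⟩
  have := hr (n + 1) c (fun S T hST => funext fun i => ?_) fun S T V => ?_
  · omega
  · obtain ⟨f, hf, hp, hi⟩ := h.exists_isBoolHom (hne i).symm
    have hq : f q = true := by
      have := hf p (z i) q
      rw [hz, hp, hi] at this
      simpa [boolMaj] using this.symm
    rw [← hc f hf hp hq i hi S, ← hc f hf hp hq i hi T, hST]
  · refine h.eq_of_isBoolHom_of_between (cmem _) (h.med_mem p q _ (cmem _) (cmem _))
      fun f hf hp hq => ?_
    rw [hf]
    by_cases hex : ∃ i, f (z i) = true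
    · obtain ⟨i, hi⟩ := hex
      simp only [hc f hf hp hq i hi]
      rfl
    · have h0 : ∀ S, f (c S) = false := fun S => by
        rw [hf.medJoin hp hq, List.any_eq_false]
        intro w hw
        obtain ⟨i, -, rfl⟩ := List.mem_map.1 hw
        exact fun hi => hex ⟨i, hi⟩
      simp [h0, boolMaj]

/-- The join in `[p, q]` of the pairwise meets of the `y i`. -/
noncomputable def meets (m : P → P → P → P) {n : ℕ} (y : Fin (n + 1) → P) (p q : P) : P :=
  medJoin m p q ((Finset.univ.offDiag : Finset (Fin (n + 1) × Fin (n + 1))).toList.map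
    fun ij => m (y ij.1) (y ij.2) p)

/-- In a median algebra of rank at most `n`, one of any `n + 1` elements of an interval lies below
the join of their pairwise meets. -/
theorem exists_join_meets_eq (h : IsMedianAlgebra m) {n : ℕ} (hr : MedianRankLE m n)
    (y : Fin (n + 1) → P) (p q : P) (hy : ∀ i, m p (y i) q = y i) :
    ∃ i, m (y i) (meets m y p q) q = meets m y p q := by
  have hs := h.symmetric
  have hpp : m p p q = p := h.localised p q
  have hqq : m p q q = q := h.med_right p q
  have hmem : m p (meets m y p q) q = meets m y p q := h.medJoin_mem fun w hw => by
    obtain ⟨ij, -, rfl⟩ := List.mem_map.1 hw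
    exact h.med_mem p q p (hy _) (hy _)
  -- Write `w` for the join of the meets. In `[w, q]` the elements `y i ∨ w` are pairwise disjoint,
  -- since `(y i ∨ w) ∧ (y j ∨ w) = (y i ∧ y j) ∨ w = w`.
  refine h.exists_eq_of_medianRankLE hr (fun i => m (y i) (meets m y p q) q) (meets m y p q) q
    (fun i => ?_) fun i j hij => ?_
  · exact Btw.med'' h.isFourPointMedian _ _ _
  · have hz : ∀ i, m p (m (y i) (meets m y p q) q) q = m (y i) (meets m y p q) q := fun i =>
      h.med_mem p q q (hy i) hmem
    refine h.eq_of_isBoolHom_of_between (h.med_mem p q _ (hz i) (hz j)) hmem fun f hf hp hq => ?_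
    have hi : f (y i) = true → f (y j) = true → f (meets m y p q) = true := fun hi hj => by
      rw [meets, hf.medJoin hp hq, List.any_eq_true]
      refine ⟨_, List.mem_map.2 ⟨(i, j), by simpa using hij, rfl⟩, ?_⟩
      rw [hf, hi, hj]
      rfl
    rw [hf, hf, hf, hq]
    cases hw : f (meets m y p q) <;> cases h1 : f (y i) <;> cases h2 : f (y j) <;>
      simp_all [boolMaj]

end IsMedianAlgebra

/-- A median algebra has rank at most `n` if one of any `n + 1` pairwise disjoint elements of an
interval is trivial. -/
theorem medianRankLE_of_exists_eq {n : ℕ}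
    (H : ∀ (x : Fin (n + 1) → P) (p q : P), (∀ i j, i ≠ j → m (x i) (x j) p = p) →
      ∃ i, m (x i) p q = p) : MedianRankLE m n := by
  intro k c hc hm
  by_contra! hk
  -- The images of the first `n + 1` coordinate vectors, available because `n < k`, are pairwise
  -- disjoint and nontrivial.
  obtain ⟨i, hi⟩ := H (fun i => c fun j => decide (j.1 = i.1)) (c fun _ => false) (c fun _ => true)
    fun i j hij => by
      rw [← hm]
      congr 1
      funext l
      have := Fin.val_ne_of_ne hij
      simp only [cubeMedian, Bool.and_false, Bool.or_false]
      grind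
  rw [← hm] at hi
  have := congrFun (hc hi) ⟨i.1, by omega⟩
  simp [cubeMedian] at this

end FiniteMedian

/-! ### Families in a coarse median space up to bounded distance -/

section Quotient

variable {X : Type u} [MetricSpace X] {μ : X → X → X → X} {T : Type v}

lemma IsCoarseMedianSpace.exists_dist_med_le (h : IsCoarseMedianSpace μ) :
    ∃ ρ : ℝ → ℝ, Monotone ρ ∧ ∀ a a' b b' c c',
      dist (μ a b c) (μ a' b' c') ≤ ρ (dist a a') + ρ (dist b b') + ρ (dist c c') := by
  obtain ⟨ρ, hρ, hb⟩ := h.bornologous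
  have hs := h.symmetric
  have hb' : ∀ a a' b c, dist (μ a b c) (μ a' b c) ≤ ρ (dist a a').toNNReal := fun a a' b c => by
    have := hb a a' b c
    rw [← NNReal.coe_le_coe, coe_nndist] at this
    rwa [← coe_nndist a a', Real.toNNReal_coe]
  refine ⟨fun r => ρ r.toNNReal, fun r s hrs => NNReal.coe_le_coe.2 (hρ (Real.toNNReal_mono hrs)),
    fun a a' b b' c c' => ?_⟩
  have h1 := hb' a a' b c
  have h2 := hb' b b' a' c
  have h3 := hb' c c' a' b'
  rw [← hs.swap_left a' b c, ← hs.swap_left a' b' c] at h2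
  rw [hs.rotate c a' b', hs.rotate c' a' b'] at h3
  exact (dist_triangle4 _ _ _ _).trans (add_le_add (add_le_add h1 h2) h3)

/-- Families of points at bounded distance from each other along a filter. -/
def BoundedAlong (l : Filter T) (x y : T → X) : Prop := ∃ C : ℝ, ∀ᶠ t in l, dist (x t) (y t) ≤ C

/-- The equivalence relation of being at bounded distance along a filter. -/
def boundedSetoid (X : Type u) [MetricSpace X] (l : Filter T) : Setoid (T → X) where
  r := BoundedAlong l
  iseqv :=
    { refl := fun x => ⟨0, by simp⟩
      symm := fun ⟨C, hC⟩ => ⟨C, by simpa only [dist_comm] using hC⟩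
      trans := fun ⟨C, hC⟩ ⟨D, hD⟩ => ⟨C + D, by
        filter_upwards [hC, hD] with t h1 h2
        exact (dist_triangle _ _ _).trans (add_le_add h1 h2)⟩ }

/-- Families of points up to bounded distance along a filter. -/
def BoundedQuotient (X : Type u) [MetricSpace X] (l : Filter T) : Type (max u v) :=
  Quotient (boundedSetoid X l)

namespace BoundedQuotient

/-- The class of a family. -/
def mk (l : Filter T) (x : T → X) : BoundedQuotient X l := Quotient.mk (boundedSetoid X l) x

lemma mk_eq_mk {l : Filter T} {x y : T → X} :
    mk l x = mk l y ↔ ∃ C : ℝ, ∀ᶠ t in l, dist (x t) (y t) ≤ C :=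
  Quotient.eq (r := boundedSetoid X l)

lemma exists_mk {l : Filter T} (a : BoundedQuotient X l) : ∃ x, mk l x = a := Quotient.exists_rep a

/-- The median induced on families up to bounded distance. -/
def med (h : IsCoarseMedianSpace μ) (l : Filter T) (a b c : BoundedQuotient X l) :
    BoundedQuotient X l :=
  Quotient.liftOn₂ a b (fun x y => Quotient.liftOn c (fun z => mk l fun t => μ (x t) (y t) (z t))
    (fun z z' ⟨C, hC⟩ => by
      obtain ⟨ρ, hρ, H⟩ := h.exists_dist_med_le
      refine mk_eq_mk.2 ⟨ρ 0 + ρ 0 + ρ C, hC.mono fun t ht => (H ..).trans ?_⟩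
      rw [dist_self, dist_self]
      exact add_le_add le_rfl (hρ ht)))
    (fun x y x' y' ⟨C, hC⟩ ⟨D, hD⟩ => by
      obtain ⟨z, rfl⟩ := exists_mk c
      obtain ⟨ρ, hρ, H⟩ := h.exists_dist_med_le
      refine mk_eq_mk.2 ⟨ρ C + ρ D + ρ 0, ?_⟩
      filter_upwards [hC, hD] with t h1 h2
      refine (H ..).trans ?_
      rw [dist_self]
      exact add_le_add (add_le_add (hρ h1) (hρ h2)) le_rfl)

lemma med_mk (h : IsCoarseMedianSpace μ) (l : Filter T) (x y z : T → X) :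
    med h l (mk l x) (mk l y) (mk l z) = mk l fun t => μ (x t) (y t) (z t) := rfl

/-- Families in a coarse median space up to bounded distance form a median algebra. -/
theorem isMedianAlgebra (h : IsCoarseMedianSpace μ) (l : Filter T) :
    IsMedianAlgebra (med h l) := by
  refine IsFourPointMedian.isMedianAlgebra ⟨fun a b => ?_, fun a b c => ?_, fun a b c d => ?_⟩ <;>
    obtain ⟨x, rfl⟩ := exists_mk a <;> obtain ⟨y, rfl⟩ := exists_mk b
  · rw [med_mk]
    congr 1
    exact funext fun t => h.localised _ _
  · obtain ⟨z, rfl⟩ := exists_mk c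
    simp only [med_mk]
    exact ⟨congrArg _ (funext fun t => (h.symmetric _ _ _).1),
      congrArg _ (funext fun t => (h.symmetric _ _ _).2)⟩
  · obtain ⟨z, rfl⟩ := exists_mk c
    obtain ⟨w, rfl⟩ := exists_mk d
    simp only [med_mk]
    obtain ⟨κ, -, hκ⟩ := h.four_point
    exact mk_eq_mk.2 ⟨κ, Eventually.of_forall fun t => hκ _ _ _ _⟩

end BoundedQuotient

/-- Coarse median spaces satisfy the five-point condition. -/
theorem IsCoarseMedianSpace.five_point (h : IsCoarseMedianSpace μ) :
    ∃ K : ℝ, ∀ a b c d e, dist (μ a b (μ c d e)) (μ (μ a b c) (μ a b d) e) ≤ K := by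
  -- Index families by all quintuples: boundedness along `⊤` is uniform boundedness.
  let mk' : (X × X × X × X × X → X) → BoundedQuotient X ⊤ := BoundedQuotient.mk ⊤
  have := (BoundedQuotient.isMedianAlgebra h ⊤).five_point (mk' fun t => t.1) (mk' fun t => t.2.1)
    (mk' fun t => t.2.2.1) (mk' fun t => t.2.2.2.1) (mk' fun t => t.2.2.2.2)
  simp only [mk', BoundedQuotient.med_mk] at this
  obtain ⟨K, hK⟩ := BoundedQuotient.mk_eq_mk.1 this
  exact ⟨K, fun a b c d e => eventually_top.1 hK (a, b, c, d, e)⟩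

/-! ### Rank of coarse median spaces -/

/-- The metric form of the rank condition of coarse median algebras. -/
def CoarseRankLE (μ : X → X → X → X) (n : ℕ) : Prop :=
  ∀ N : ℕ, ∃ D : ℕ, ∀ (x : Fin (n + 1) → X) (p q : X),
    (∀ i j, i ≠ j → dist p (μ (x i) (x j) p) ≤ N) → ∃ i, dist p (μ (x i) p q) ≤ D

open BoundedQuotient in
-- Take a sequence of counterexamples with `D = k`. Its approximations `P k` have one common error,
-- so their product maps homomorphically to families modulo bounded distance, where approximate
-- disjointness becomes exact.
theorem SpaceRankLE.coarseRankLE (h : IsCoarseMedianSpace μ) {n : ℕ} (hr : SpaceRankLE μ n) :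
    CoarseRankLE μ n := by
  classical
  obtain ⟨H, hH⟩ := hr
  intro N
  by_contra! hN
  choose x p q hx hfar using hN
  let A : ℕ → Finset X := fun k => insert (p k) (insert (q k) (Finset.univ.image (x k)))
  have hA : ∀ k, (A k).card ≤ n + 3 := fun k => by
    have h1 := Finset.card_insert_le (p k) (insert (q k) (Finset.univ.image (x k)))
    have h2 := Finset.card_insert_le (q k) (Finset.univ.image (x k))
    have h3 := Finset.card_image_le (s := Finset.univ) (f := x k)
    simp only [Finset.card_univ, Fintype.card_fin] at h3
    simp only [A]
    omega
  choose P _ m proj lam hm hrank hlam hproj using fun k =>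
    hH (n + 3) (A k) ⟨p k, by simp [A]⟩ (hA k)
  let p' : ∀ k, P k := fun k => proj k ⟨p k, by simp [A]⟩
  let q' : ∀ k, P k := fun k => proj k ⟨q k, by simp [A]⟩
  let x' : Fin (n + 1) → ∀ k, P k := fun i k => proj k ⟨x k i, by simp [A]⟩
  let Λ : (∀ k, P k) → BoundedQuotient X (atTop : Filter ℕ) := fun g => mk _ fun k => lam k (g k)
  let M := med h (atTop : Filter ℕ)
  let m' : (∀ k, P k) → (∀ k, P k) → (∀ k, P k) → ∀ k, P k := fun g g' g'' k =>
    m k (g k) (g' k) (g'' k)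
  have hM : IsMedianAlgebra M := isMedianAlgebra h _
  have hΛ : ∀ g g' g'', Λ (m' g g' g'') = M (Λ g) (Λ g') (Λ g'') := fun g g' g'' =>
    mk_eq_mk.2 ⟨H (n + 3), Eventually.of_forall fun k => hlam k _ _ _⟩
  have hp : Λ p' = mk _ p := mk_eq_mk.2 ⟨H (n + 3), Eventually.of_forall fun k => by
    rw [dist_comm]; exact hproj k ⟨p k, _⟩⟩
  have hq : Λ q' = mk _ q := mk_eq_mk.2 ⟨H (n + 3), Eventually.of_forall fun k => by
    rw [dist_comm]; exact hproj k ⟨q k, _⟩⟩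
  have hxx : ∀ i, Λ (x' i) = mk _ fun k => x k i := fun i =>
    mk_eq_mk.2 ⟨H (n + 3), Eventually.of_forall fun k => by
      rw [dist_comm]; exact hproj k ⟨x k i, _⟩⟩
  have hdis : ∀ i j, i ≠ j → M (Λ (x' i)) (Λ (x' j)) (Λ p') = Λ p' := fun i j hij => by
    rw [hxx, hxx, hp]
    refine mk_eq_mk.2 ⟨N, Eventually.of_forall fun k => ?_⟩
    rw [dist_comm]
    exact hx k i j hij
  -- Projecting puts the points exactly into the intervals of the `P k`. Their disjointness there is
  -- still only approximate; the join `w` of their pairwise meets absorbs the defect, being at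
  -- bounded distance from `p'`.
  let y : Fin (n + 1) → ∀ k, P k := fun i => m' (x' i) p' q'
  let w : ∀ k, P k := IsMedianAlgebra.meets m' y p' q'
  have hyΛ : ∀ i, Λ (y i) = mk _ fun k => μ (x k i) (p k) (q k) := fun i => by
    rw [hΛ, hxx, hp, hq]; rfl
  have hy : ∀ i j, i ≠ j → Λ (m' (y i) (y j) p') = Λ p' := fun i j hij => by
    have hs := hM.symmetric
    have := hM.proj_med (Λ p') (Λ q') (Λ (x' i)) (Λ (x' j)) (Λ p')
    rw [hdis i j hij, hM.localised] at this
    rw [hΛ, hΛ, hΛ, hs.swap_left (Λ (x' i)), hs.swap_left (Λ (x' j)), ← this]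
  have hw : Λ w = Λ p' := by
    simp only [w, IsMedianAlgebra.meets]
    rw [map_medJoin hΛ]
    generalize hL : (Finset.univ.offDiag : Finset (Fin (n + 1) × Fin (n + 1))).toList = L
    have hmem : ∀ ij ∈ L, ij.1 ≠ ij.2 := fun ij hij => by
      rw [← hL] at hij
      simpa using hij
    clear hL
    induction L with
    | nil => rfl
    | cons ij L ih =>
      simp only [List.map_cons, List.foldr_cons]
      rw [ih fun a ha => hmem a (by simp [ha]), hy _ _ (hmem ij (by simp)), hM.localised]
  have hyw : ∀ i, Λ (m' (y i) w q') = Λ (y i) := fun i => by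
    rw [hΛ, hw, hΛ, ← hM.symmetric.reverse (Λ q'), hM.symmetric.reverse _ (Λ p') (Λ q')]
    rw [hM.symmetric.swap_right]
    exact Btw.med hM.isFourPointMedian _ _ _
  have hex : ∀ k, ∃ i, m k (y i k) (w k) (q' k) = w k := fun k => by
    have hwk : w k = IsMedianAlgebra.meets (m k) (fun i => y i k) (p' k) (q' k) := by
      simp only [w, IsMedianAlgebra.meets]
      rw [map_medJoin (f := fun g : ∀ k, P k => g k) (m' := m k) fun _ _ _ => rfl, medJoin]
      simp only [List.foldr_map]
      rfl
    rw [hwk]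
    refine (hm k).exists_join_meets_eq (hrank k) _ _ _ fun i => ?_
    exact Btw.med'' (hm k).isFourPointMedian _ _ _
  obtain ⟨C, hC⟩ := mk_eq_mk.1 (hw.trans hp)
  choose D hD using fun i => mk_eq_mk.1 ((hyw i).trans (hyΛ i))
  have hD' := eventually_all.2 hD
  -- The index `i` found in `P k` depends on `k`, so the bounds for all `i` are needed at once.
  obtain ⟨k, hk1, hk2, hk3⟩ := (hC.and (hD'.and
    (eventually_ge_atTop ⌈C + ∑ i, |D i|⌉₊))).exists
  obtain ⟨i, hi⟩ := hex k
  have h1 := hk2 i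
  simp only [m', hi] at h1
  have h2 := (dist_triangle_left (p k) (μ (x k i) (p k) (q k)) (lam k (w k))).trans
    (add_le_add hk1 h1)
  have h3 : D i ≤ ∑ i, |D i| := (le_abs_self _).trans
    (Finset.single_le_sum (f := fun i => |D i|) (fun i _ => abs_nonneg _) (Finset.mem_univ i))
  have h4 := (Nat.le_ceil _).trans (Nat.cast_le (α := ℝ).2 hk3)
  have h5 := hfar k i
  linarith

open BoundedQuotient in
-- Suppose sets `A k` of at most `p` points cannot be approximated with error `k`. Enumerations of
-- the `A k` give `p` points of an ultrafilter quotient of rank at most `n`; they generate a finite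
-- subalgebra, whose representatives approximate `A k` for most `k`.
theorem CoarseRankLE.spaceRankLE (h : IsCoarseMedianSpace μ) {n : ℕ} (hr : CoarseRankLE μ n) :
    SpaceRankLE μ n := by
  classical
  suffices H : ∀ p : ℕ, ∃ k : ℕ, ∀ A : Finset X, A.Nonempty → A.card ≤ p →
      ∃ (P : Type) (_ : Finite P) (m : P → P → P → P) (proj : A → P) (lam : P → X),
        IsMedianAlgebra m ∧ MedianRankLE m n ∧
        (∀ x y z, dist (lam (m x y z)) (μ (lam x) (lam y) (lam z)) ≤ k) ∧
        ∀ a : A, dist (a : X) (lam (proj a)) ≤ k by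
    choose k hk using H
    exact ⟨fun p => k p, fun p A hA hp => by simpa using hk p A hA hp⟩
  intro p
  by_contra! hcon
  choose A hA hcard hbad using hcon
  have hsurj : ∀ k, ∃ a : Fin p → A k, Function.Surjective a := fun k => by
    have : Nonempty (A k) := (hA k).to_subtype
    obtain ⟨e⟩ : Nonempty (A k ↪ Fin p) := Function.Embedding.nonempty_of_card_le (by simpa using hcard k)
    exact ⟨Function.invFun e, Function.invFun_surjective e.injective⟩
  choose a ha using hsurj
  -- An ultrafilter is needed in the rank bound below: failure of a bound along `U` must hold
  -- eventually, hence for all `i` simultaneously.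
  let U := hyperfilter ℕ
  let Q := BoundedQuotient X (U : Filter ℕ)
  let M := med h (U : Filter ℕ)
  have hM : IsMedianAlgebra M := isMedianAlgebra h _
  let b : Fin p → Q := fun i => mk _ fun k => a k i
  -- the subalgebra generated by the `b i`
  let S : Set Q := ⋂₀ {s | (∀ i, b i ∈ s) ∧ ∀ x ∈ s, ∀ y ∈ s, ∀ z ∈ s, M x y z ∈ s}
  have hbS : ∀ i, b i ∈ S := fun i s hs => hs.1 i
  have hMS : ∀ x ∈ S, ∀ y ∈ S, ∀ z ∈ S, M x y z ∈ S := fun x hx y hy z hz s hs =>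
    hs.2 x (hx s hs) y (hy s hs) z (hz s hs)
  let mS : S → S → S → S := fun x y z => ⟨M x y z, hMS _ x.2 _ y.2 _ z.2⟩
  have hmS : IsMedianAlgebra mS :=
    ⟨fun a b => Subtype.ext (hM.localised _ _), fun a b c => ⟨Subtype.ext (hM.symmetric _ _ _).1,
      Subtype.ext (hM.symmetric _ _ _).2⟩, fun a b c d e => Subtype.ext (hM.five_point _ _ _ _ _)⟩
  have hfin : Finite S := hmS.finite_of_generated (fun i => (⟨b i, hbS i⟩ : S)) fun s hs hs' => by
    refine Set.eq_univ_of_forall fun x => ?_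
    have := x.2 (Subtype.val '' s) ⟨fun i => ⟨_, hs i, rfl⟩, ?_⟩
    · obtain ⟨y, hy, hxy⟩ := this
      rwa [← Subtype.ext hxy]
    · rintro _ ⟨x, hx, rfl⟩ _ ⟨y, hy, rfl⟩ _ ⟨z, hz, rfl⟩
      exact ⟨mS x y z, hs' _ hx _ hy _ hz, rfl⟩
  have hrank : MedianRankLE M n := medianRankLE_of_exists_eq fun x p q hd => by
    choose x' hx' using fun i => exists_mk (x i)
    obtain ⟨p', hp'⟩ := exists_mk p
    obtain ⟨q', hq'⟩ := exists_mk q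
    simp only [← hx', ← hp', ← hq', M, med_mk] at hd ⊢
    choose C hC using fun (i j : Fin (n + 1)) =>
      show ∃ C : ℝ, i ≠ j → ∀ᶠ k in (U : Filter ℕ),
        dist (μ (x' i k) (x' j k) (p' k)) (p' k) ≤ C from
      if hij : i = j then ⟨0, fun h => absurd hij h⟩ else
        (mk_eq_mk.1 (hd i j hij)).imp fun C hC _ => hC
    let N := ⌈∑ i, ∑ j, |C i j|⌉₊
    have hCN : ∀ i j, C i j ≤ N := fun i j => by
      have h1 := Finset.single_le_sum (f := fun j => |C i j|) (fun _ _ => abs_nonneg _)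
        (Finset.mem_univ j)
      have h2 := Finset.single_le_sum (f := fun i => ∑ j, |C i j|)
        (fun _ _ => Finset.sum_nonneg fun _ _ => abs_nonneg _) (Finset.mem_univ i)
      exact (le_abs_self _).trans (h1.trans (h2.trans (Nat.le_ceil _)))
    obtain ⟨D, hD⟩ := hr N
    have hall : ∀ᶠ k in (U : Filter ℕ), ∀ i j, i ≠ j →
        dist (p' k) (μ (x' i k) (x' j k) (p' k)) ≤ N := by
      refine eventually_all.2 fun i => eventually_all.2 fun j => ?_
      by_cases hij : i = j
      · exact Eventually.of_forall fun k h => absurd hij h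
      · filter_upwards [hC i j hij] with k hk _
        rw [dist_comm]
        exact hk.trans (hCN i j)
    by_contra! hne
    have hev : ∀ i, ∀ᶠ k in (U : Filter ℕ), ¬ dist (μ (x' i k) (p' k) (q' k)) (p' k) ≤ D :=
      fun i => Ultrafilter.eventually_not.2 fun hi => hne i (mk_eq_mk.2 ⟨D, hi⟩)
    obtain ⟨k, hk1, hk2⟩ := (hall.and (eventually_all.2 hev)).exists
    obtain ⟨i, hi⟩ := hD _ _ _ hk1
    exact hk2 i (by rwa [dist_comm])
  -- Transport to `Fin N`, since the approximating algebra must live in `Type`.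
  obtain ⟨N, ⟨e⟩⟩ := Finite.exists_equiv_fin S
  choose g hg using fun s : S => exists_mk s.1
  choose C hC using fun x y z : S => show ∃ C : ℝ, ∀ᶠ k in (U : Filter ℕ),
    dist (g (mS x y z) k) (μ (g x k) (g y k) (g z k)) ≤ C from mk_eq_mk.1 <| by
      rw [← med_mk h, hg, hg, hg, hg]
  choose C' hC' using fun i : Fin p => show ∃ C : ℝ, ∀ᶠ k in (U : Filter ℕ),
    dist (a k i : X) (g ⟨b i, hbS i⟩ k) ≤ C from mk_eq_mk.1 (hg ⟨b i, hbS i⟩).symm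
  have := Fintype.ofFinite S
  have hle : (U : Filter ℕ) ≤ atTop := Nat.hyperfilter_le_atTop
  have hbound : ∀ c : ℝ, ∀ᶠ k in (U : Filter ℕ), c ≤ (k : ℕ) := fun c =>
    hle (tendsto_natCast_atTop_atTop.eventually_ge_atTop c)
  -- There are finitely many error constants, so `U`-most `k` exceed all of them.
  obtain ⟨k, h1, h2, h3, h4⟩ :=
    ((eventually_all.2 fun x => eventually_all.2 fun y => eventually_all.2 (hC x y)).and
      ((eventually_all.2 hC').and
      ((eventually_all.2 fun x => eventually_all.2 fun y => eventually_all.2 fun z =>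
        hbound (C x y z)).and (eventually_all.2 fun i => hbound (C' i))))).exists
  obtain ⟨s, hs⟩ := (ha k).hasRightInverse
  obtain ⟨t, ht⟩ := hbad k (Fin N) inferInstance
    (fun x y z => e (mS (e.symm x) (e.symm y) (e.symm z))) (fun t => e ⟨b (s t), hbS _⟩)
    (fun x => g (e.symm x) k)
    ⟨fun x y => by simp [hmS.localised _ _],
      fun x y z => ⟨by rw [(hmS.symmetric _ _ _).1], by rw [(hmS.symmetric _ _ _).2]⟩,
      fun x y z u v => by simp only [Equiv.symm_apply_apply, ← hmS.five_point]⟩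
    (fun d c hc hcm => hrank d (fun x => (e.symm (c x)).1)
      (Subtype.val_injective.comp (e.symm.injective.comp hc))
      fun x y z => by rw [hcm, Equiv.symm_apply_apply])
    (fun x y z => by
      rw [Equiv.symm_apply_apply]
      exact (h1 _ _ _).trans (h3 _ _ _))
  have h5 := (h2 (s t)).trans (h4 (s t))
  rw [hs t] at h5
  rw [Equiv.symm_apply_apply] at ht
  exact absurd h5 (not_le.2 ht)

end Quotient

/-! ### The algebra underlying a coarse median space -/

section SpaceToAlgebra

/-- A chain of bounded steps in a finite set bounds the distance between its endpoints. -/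
lemma dist_le_of_chain {X : Type u} [MetricSpace X] {r : ℝ} (hr : 0 ≤ r) {S : Set X}
    (hS : S.Finite) (N : ℕ) (z : ℕ → X) (hz : ∀ i ≤ N, z i ∈ S)
    (hd : ∀ i < N, dist (z i) (z (i + 1)) ≤ r) : dist (z 0) (z N) ≤ r * ((S.ncard - 1 : ℕ) : ℝ) := by
  classical
  generalize hk : S.ncard = k
  induction k generalizing S N z with
  | zero => simp [(Set.ncard_eq_zero hS).1 hk] at hz; exact absurd (hz 0) (by simp)
  | succ k ih =>
    -- Jump to the last visit to `z 0`; the rest of the chain stays in `S \ {z 0}`.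
    set i := Nat.findGreatest (fun i => z i = z 0) N with hi
    have hiN : i ≤ N := Nat.findGreatest_le N
    have hzi : z i = z 0 := Nat.findGreatest_spec (P := fun i => z i = z 0) (Nat.zero_le N) rfl
    rcases hiN.eq_or_lt with h | h
    · rw [← h, hzi, dist_self]
      positivity
    · have hne : ∀ j, i < j → j ≤ N → z j ≠ z 0 := fun j h1 h2 =>
        Nat.findGreatest_is_greatest h1 h2
      have h1 := ih (S := S \ {z 0}) (hS.sdiff) (N - (i + 1)) (fun j => z (i + 1 + j))
        (fun j hj => ⟨hz _ (by omega), hne _ (by omega) (by omega)⟩)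
        (fun j hj => hd _ (by omega))
        (by rw [Set.ncard_sdiff_singleton_of_mem (hz 0 (by omega)), hk]; rfl)
      have hk1 : 1 ≤ k := by
        have : 0 < (S \ {z 0}).ncard := (Set.ncard_pos hS.sdiff).2
          ⟨z N, hz _ le_rfl, hne N h le_rfl⟩
        rw [Set.ncard_sdiff_singleton_of_mem (hz 0 (by omega)), hk] at this
        omega
      have h2 := hd i h
      rw [hzi] at h2
      simp only [add_zero, show i + 1 + (N - (i + 1)) = N by omega] at h1
      refine (dist_triangle _ _ _).trans ((add_le_add h2 h1).trans ?_)
      rw [Nat.cast_sub hk1]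
      simp only [Nat.add_sub_cancel]
      push_cast
      linarith

variable {X : Type u} [MetricSpace X] {μ : X → X → X → X}

/-- Sample the quasi-geodesic at the integers, stopping at parameter `dist a b`. -/
lemma QuasiGeodesicSpace.exists_chain (hq : QuasiGeodesicSpace X) :
    ∃ R : ℝ, ∀ a b : X, ∃ y : ℕ → X, y 0 = a ∧ y ⌈dist a b⌉₊ = b ∧
      ∀ j, dist (y j) (y (j + 1)) ≤ R := by
  obtain ⟨L, C, hL, hC, hγ⟩ := hq
  refine ⟨L + C, fun a b => ?_⟩
  obtain ⟨γ, h0, h1, h⟩ := hγ a b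
  refine ⟨fun j => γ (min j (dist a b)), by simp [h0], ?_, fun j => ?_⟩
  · simp only [min_eq_right (Nat.le_ceil (dist a b)), h1]
  · have hmem : ∀ j : ℕ, min (j : ℝ) (dist a b) ∈ Set.Icc 0 (dist a b) := fun j =>
      ⟨le_min (Nat.cast_nonneg _) dist_nonneg, min_le_right _ _⟩
    refine (h _ (hmem j) _ (hmem (j + 1))).2.trans ?_
    have : |min (j : ℝ) (dist a b) - min ((j + 1 : ℕ) : ℝ) (dist a b)| ≤ 1 := by
      refine (abs_min_sub_min_le_max _ _ _ _).trans ?_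
      push_cast
      simp
    nlinarith

namespace IsCoarseMedianSpace

lemma exists_cardLE_interval (h : IsCoarseMedianSpace μ) (hb : BoundedGeometry X) (r : ℝ) :
    ∃ N : ℕ, ∀ a b, dist a b ≤ r → CardLE (interval μ a b) N := by
  obtain ⟨ρ, hρ, H⟩ := h.exists_dist_med_le
  obtain ⟨N, hN⟩ := hb (max 1 (ρ 0 + ρ 0 + ρ r)) (by positivity)
  refine ⟨N, fun a b hab => ?_⟩
  have hball : CardLE (Metric.closedBall a (max 1 (ρ 0 + ρ 0 + ρ r))) N :=
    ⟨(hN a).1, by exact_mod_cast (hN a).2⟩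
  refine hball.mono ?_ le_rfl
  rintro _ ⟨x, rfl⟩
  -- Compare `μ a x b` with `μ a x a = a`.
  have := H a a x x b a
  rw [dist_self, dist_self, h.symmetric.swap_right a x a, h.localised, dist_comm b a] at this
  exact le_max_of_le_right (this.trans (add_le_add le_rfl (hρ hab)))

/-- In a quasi-geodesic coarse median space the distance is linearly bounded by the cardinality of
the interval. -/
lemma exists_dist_le_ncard (h : IsCoarseMedianSpace μ) (hb : BoundedGeometry X)
    (hq : QuasiGeodesicSpace X) :
    ∃ r : ℝ, 0 < r ∧ ∀ a b, dist a b ≤ r * (((interval μ a b).ncard - 1 : ℕ) : ℝ) := by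
  obtain ⟨ρ, hρ, H⟩ := h.exists_dist_med_le
  obtain ⟨R, hR⟩ := hq.exists_chain
  refine ⟨max 1 (ρ 0 + ρ R + ρ 0), by positivity, fun a b => ?_⟩
  obtain ⟨y, h0, h1, hy⟩ := hR a b
  obtain ⟨N, hN⟩ := h.exists_cardLE_interval hb (dist a b)
  -- Project the chain into `[a, b]`; its steps stay bounded and its endpoints stay fixed.
  have := dist_le_of_chain (r := max 1 (ρ 0 + ρ R + ρ 0)) (by positivity) (hN a b le_rfl).1
    ⌈dist a b⌉₊ (fun i => μ a (y i) b) (fun i _ => ⟨y i, rfl⟩) fun i _ => by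
      refine le_max_of_le_right ((H ..).trans ?_)
      rw [dist_self, dist_self]
      exact add_le_add (add_le_add le_rfl (hρ (hy i))) le_rfl
  simp only [h0, h1] at this
  rwa [h.localised, h.symmetric.rotate a b b, h.localised] at this

lemma ncard_pos (h : IsCoarseMedianSpace μ) (hb : BoundedGeometry X) (a b : X) :
    0 < (interval μ a b).ncard := by
  obtain ⟨N, hN⟩ := h.exists_cardLE_interval hb (dist a b)
  exact (Set.ncard_pos (hN a b le_rfl).1).2 ⟨a, left_mem_interval h.localised a b⟩

lemma isCoarseMedianAlgebra (h : IsCoarseMedianSpace μ) (hb : BoundedGeometry X) :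
    IsCoarseMedianAlgebra μ where
  finite a b := by
    obtain ⟨N, hN⟩ := h.exists_cardLE_interval hb (dist a b)
    exact (hN a b le_rfl).1
  localised := h.localised
  symmetric := h.symmetric
  five_point := by
    obtain ⟨K, hK⟩ := h.five_point
    obtain ⟨N, hN⟩ := h.exists_cardLE_interval hb K
    exact ⟨N, fun a b c d e => hN _ _ (hK a b c d e)⟩

lemma exists_dist_le_of_cardLE (h : IsCoarseMedianSpace μ) (hb : BoundedGeometry X)
    (hq : QuasiGeodesicSpace X) :
    ∃ r : ℝ≥0, 0 < r ∧ ∀ a b R, ((interval μ a b).ncard : ℝ≥0) ≤ R → nndist a b ≤ r * R := by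
  obtain ⟨r, hr, H⟩ := h.exists_dist_le_ncard hb hq
  refine ⟨r.toNNReal, Real.toNNReal_pos.2 hr, fun a b R hR => ?_⟩
  rw [← NNReal.coe_le_coe, coe_nndist, NNReal.coe_mul, Real.coe_toNNReal _ hr.le]
  refine (H a b).trans (mul_le_mul_of_nonneg_left ?_ hr.le)
  refine le_trans (Nat.cast_le.2 (Nat.sub_le _ 1)) ?_
  exact_mod_cast NNReal.coe_le_coe.2 hR

lemma boundedValency (h : IsCoarseMedianSpace μ) (hb : BoundedGeometry X)
    (hq : QuasiGeodesicSpace X) : BoundedValency μ := by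
  obtain ⟨r, -, H⟩ := h.exists_dist_le_of_cardLE hb hq
  choose N hN using fun R : ℝ≥0 => hb (r * R + 1) (by positivity)
  refine ⟨fun R => N R, fun R x => ?_⟩
  have hball : CardLE (Metric.closedBall x (r * R + 1)) (N R) :=
    ⟨(hN R x).1, by exact_mod_cast (hN R x).2⟩
  refine hball.mono (fun y hy => ?_) le_rfl
  have := NNReal.coe_le_coe.2 (H x y R hy.2)
  rw [coe_nndist] at this
  rw [Metric.mem_closedBall, dist_comm]
  push_cast at this
  linarith

lemma quasiGeodesicAlgebra (h : IsCoarseMedianSpace μ) (hb : BoundedGeometry X)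
    (hq : QuasiGeodesicSpace X) : QuasiGeodesicAlgebra μ := by
  obtain ⟨r, hr, H⟩ := h.exists_dist_le_of_cardLE hb hq
  obtain ⟨R, hR⟩ := hq.exists_chain
  obtain ⟨N, hN⟩ := h.exists_cardLE_interval hb R
  -- The chain has `⌈dist a b⌉₊` steps, at most `r * c + 1 ≤ (r + 1) * c` where `c ≥ 1` is the
  -- cardinality of the interval.
  refine ⟨r + 1, N + 1, by positivity, by positivity, fun a b => ?_⟩
  obtain ⟨y, h0, h1, hy⟩ := hR a b
  refine ⟨_, y, h0, h1, fun j _ => (hN _ _ (hy j)).mono subset_rfl ?_, fun hf => ?_⟩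
  · rw [add_assoc]
    exact le_self_add
  · have h2 := H a b _ le_rfl
    have h3 : (1 : ℝ≥0) ≤ (interval μ a b).ncard := by
      exact_mod_cast h.ncard_pos hb a b
    have h4 := (Nat.ceil_lt_add_one (dist_nonneg (x := a) (y := b))).le
    have h5 : (⌈dist a b⌉₊ : ℝ≥0) ≤ nndist a b + 1 := by
      rw [← NNReal.coe_le_coe]
      push_cast
      exact h4
    refine h5.trans ((add_le_add h2 h3).trans ?_)
    rw [add_mul, one_mul]

end IsCoarseMedianSpace

/-! ### Morphisms after forgetting the metric -/

section Maps

variable {Y : Type u} [MetricSpace Y] {μX : X → X → X → X} {μY : Y → Y → Y → Y}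

lemma exists_monotone_cardLE_interval (h : IsCoarseMedianSpace μ) (hb : BoundedGeometry X) :
    ∃ φ : ℝ≥0 → ℝ≥0, Monotone φ ∧ ∀ a b R, nndist a b ≤ R → CardLE (interval μ a b) (φ R) := by
  choose N hN using fun r : ℕ => h.exists_cardLE_interval hb r
  -- Summing the bounds up to `⌈R⌉₊` gives a monotone majorant.
  refine ⟨fun R => ∑ i ∈ Finset.range (⌈R⌉₊ + 1), (N i : ℝ≥0), fun R S hRS => ?_,
    fun a b R hR => ?_⟩
  · refine Finset.sum_le_sum_of_subset (Finset.range_subset_range.2 ?_)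
    exact Nat.succ_le_succ (Nat.ceil_mono hRS)
  · refine (hN ⌈R⌉₊ a b ?_).mono subset_rfl ?_
    · rw [← coe_nndist]
      exact_mod_cast hR.trans (Nat.le_ceil R)
    · exact Finset.single_le_sum (f := fun i => (N i : ℝ≥0)) (fun _ _ => zero_le)
        (Finset.mem_range.2 (Nat.lt_succ_self _))

lemma IsCoarseMedianMorphism.isAlgebraMap (hX : IsCoarseMedianSpace μX)
    (hbX : BoundedGeometry X) (hqX : QuasiGeodesicSpace X) (hY : IsCoarseMedianSpace μY)
    (hbY : BoundedGeometry Y) {f : X → Y} (hf : IsCoarseMedianMorphism μX μY f) :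
    IsAlgebraMap μX μY f where
  finite_to_one y := by
    have hB := hf.coarse.proper {y} Bornology.isBounded_singleton
    rcases (f ⁻¹' {y}).eq_empty_or_nonempty with h | ⟨x, -⟩
    · rw [h]; exact Set.finite_empty
    · obtain ⟨r, hr⟩ := hB.subset_closedBall x
      obtain ⟨N, hN⟩ := hbX (max 1 r) (by positivity)
      exact (hN x).1.subset (hr.trans (Metric.closedBall_subset_closedBall (le_max_right _ _)))
  quasi := by
    obtain ⟨C, -, hC⟩ := hf.quasi
    obtain ⟨N, hN⟩ := hY.exists_cardLE_interval hbY C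
    exact ⟨N, fun a b c => hN _ _ (hC a b c)⟩
  controlled := by
    obtain ⟨ρ, hρ, -, H⟩ := hf.coarse.bornologous
    obtain ⟨r, -, hr⟩ := hX.exists_dist_le_of_cardLE hbX hqX
    obtain ⟨φ, hφ, hφ'⟩ := exists_monotone_cardLE_interval hY hbY
    refine ⟨fun R => φ (ρ (r * R)), fun R S hRS => hφ (hρ (mul_le_mul_right hRS r)),
      fun a b => (hφ' _ _ _ ((H a b).trans (hρ ?_))).2⟩
    exact hr a b _ le_rfl

lemma Close.algClose {W : Type u} (hY : IsCoarseMedianSpace μY) (hbY : BoundedGeometry Y)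
    {f g : W → Y} (h : Close f g) : AlgClose μY f g := by
  obtain ⟨s, hs⟩ := h
  obtain ⟨N, hN⟩ := hY.exists_cardLE_interval hbY s
  exact ⟨N, fun x => hN _ _ (hs x)⟩

end Maps

/-- The conditions differ only in measuring by distance or by cardinality, and `H` and `φ'` convert
each into the other. -/
theorem coarseRankLE_iff_algebraRankLE (h : IsCoarseMedianSpace μ) (hb : BoundedGeometry X)
    (hq : QuasiGeodesicSpace X) (n : ℕ) : CoarseRankLE μ n ↔ AlgebraRankLE μ n := by
  classical
  obtain ⟨r, hr, H⟩ := h.exists_dist_le_of_cardLE hb hq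
  obtain ⟨φ, hφ, hφ'⟩ := exists_monotone_cardLE_interval h hb
  constructor
  · intro hn
    choose D hD using hn
    let E : ℝ≥0 → ℝ≥0 := fun R => ∑ i ∈ Finset.range (⌈r * R⌉₊ + 1), (D i : ℝ≥0)
    refine ⟨fun R => φ (E R), fun R S hRS => hφ ?_, fun x p q => ?_⟩
    · refine Finset.sum_le_sum_of_subset (Finset.range_subset_range.2 ?_)
      exact Nat.succ_le_succ (Nat.ceil_mono (mul_le_mul_right hRS r))
    · set R : ℝ≥0 := (Finset.univ.offDiag : Finset (Fin (n + 1) × Fin (n + 1))).sup fun ij =>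
        ((interval μ p (μ (x ij.1) (x ij.2) p)).ncard : ℝ≥0) with hR
      obtain ⟨i, hi⟩ := hD ⌈r * R⌉₊ x p q fun i j hij => by
        have h1 : ((interval μ p (μ (x i) (x j) p)).ncard : ℝ≥0) ≤ R :=
          Finset.le_sup (f := fun ij : Fin (n + 1) × Fin (n + 1) =>
            ((interval μ p (μ (x ij.1) (x ij.2) p)).ncard : ℝ≥0)) (b := (i, j)) (by simpa using hij)
        rw [← coe_nndist]
        exact_mod_cast (H _ _ _ h1).trans (Nat.le_ceil _)
      refine ⟨i, (hφ' _ _ _ ?_).2⟩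
      have h2 : (D ⌈r * R⌉₊ : ℝ≥0) ≤ E R :=
        Finset.single_le_sum (f := fun i => (D i : ℝ≥0)) (fun _ _ => zero_le)
          (Finset.mem_range.2 (Nat.lt_succ_self _))
      refine le_trans ?_ h2
      rw [← NNReal.coe_le_coe, coe_nndist]
      exact_mod_cast hi
  · rintro ⟨ψ, hψ, hn⟩ N
    refine ⟨⌈r * ψ (φ N)⌉₊, fun x p q hx => ?_⟩
    obtain ⟨i, hi⟩ := hn x p q
    refine ⟨i, ?_⟩
    have h1 := H _ _ _ (hi.trans (hψ (Finset.sup_le (a := φ N) fun ij hij => ?_)))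
    · rw [← coe_nndist]
      exact_mod_cast h1.trans (Nat.le_ceil _)
    · refine (hφ' _ _ _ ?_).2
      rw [← NNReal.coe_le_coe, coe_nndist]
      exact_mod_cast hx ij.1 ij.2 (by simpa using hij)

theorem spaceRankLE_iff_algebraRankLE (h : IsCoarseMedianSpace μ) (hb : BoundedGeometry X)
    (hq : QuasiGeodesicSpace X) (n : ℕ) : SpaceRankLE μ n ↔ AlgebraRankLE μ n := by
  rw [← coarseRankLE_iff_algebraRankLE h hb hq]
  exact ⟨fun hn => hn.coarseRankLE h, fun hn => hn.spaceRankLE h⟩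

theorem forgetfulWellDefined : ForgetfulWellDefined.{u} where
  isAlgebra X := X.obj.isCoarseMedianSpace.isCoarseMedianAlgebra X.property.1
  boundedValency X := X.obj.isCoarseMedianSpace.boundedValency X.property.1 X.property.2
  quasiGeodesic X := X.obj.isCoarseMedianSpace.quasiGeodesicAlgebra X.property.1 X.property.2
  map X Y _ hf := hf.isAlgebraMap X.obj.isCoarseMedianSpace X.property.1 X.property.2
    Y.obj.isCoarseMedianSpace Y.property.1
  close _ Y _ _ _ _ h := h.algClose Y.obj.isCoarseMedianSpace Y.property.1

end SpaceToAlgebra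

/-! ### The coarse median space induced by a coarse median algebra -/

section AlgebraToSpace

/-- `a` and `b` are joined by a chain of `N` steps of length at most `r`. -/
def Joined {X : Type u} [MetricSpace X] (r : ℝ) (N : ℕ) (a b : X) : Prop :=
  ∃ y : ℕ → X, y 0 = a ∧ y N = b ∧ ∀ j < N, dist (y j) (y (j + 1)) ≤ r

namespace Joined

variable {X : Type u} [MetricSpace X] {r : ℝ} {a b c : X} {N K : ℕ}

lemma refl (r : ℝ) (a : X) : Joined r 0 a a := ⟨fun _ => a, rfl, rfl, by simp⟩

lemma trans (h : Joined r N a b) (h' : Joined r K b c) : Joined r (N + K) a c := by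
  obtain ⟨y, y0, y1, hy⟩ := h
  obtain ⟨z, z0, z1, hz⟩ := h'
  refine ⟨fun i => if i ≤ N then y i else z (i - N), by simpa using y0, ?_, fun j hj => ?_⟩
  · rcases Nat.eq_zero_or_pos K with rfl | hK
    · simp [y1, ← z1, z0]
    · simp [hK.ne', z1]
  · rcases lt_trichotomy j N with h | rfl | h
    · simp [h.le, Nat.succ_le_of_lt h, hy j h]
    · have := hz 0 (by omega)
      simpa [y1, ← z0] using this
    · have h1 : ¬ j ≤ N := by omega
      have h2 : ¬ j + 1 ≤ N := by omega
      have := hz (j - N) (by omega)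
      rw [← Nat.sub_add_comm h.le] at this
      simpa [h1, h2] using this

lemma dist_le (h : Joined r N a b) : dist a b ≤ r * N := by
  obtain ⟨y, rfl, rfl, hy⟩ := h
  refine (dist_le_range_sum_dist y N).trans ((Finset.sum_le_sum fun i hi =>
    hy i (Finset.mem_range.1 hi)).trans ?_)
  simp [mul_comm]

end Joined

/-- A metric space is quasi-geodesic if any two points are joined by chains of bounded steps whose
length is linearly bounded by the distance. -/
theorem quasiGeodesicSpace_of_joined {X : Type u} [MetricSpace X] {A r : ℝ} (hA : 0 < A)
    (hr : 0 < r) (H : ∀ a b : X, ∃ N : ℕ, Joined r N a b ∧ N ≤ A * dist a b) :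
    QuasiGeodesicSpace X := by
  classical
  -- The additive constant pays for rounding to chain indices: `r` in the upper bound, `A⁻¹` in the
  -- lower.
  refine ⟨r * A, r + A⁻¹, by positivity, by positivity, fun a b => ?_⟩
  rcases eq_or_ne a b with rfl | hab
  · refine ⟨fun _ => a, rfl, rfl, fun s hs t ht => ?_⟩
    rw [dist_self, Set.Icc_self] at hs ht
    rw [Set.mem_singleton_iff.1 hs, Set.mem_singleton_iff.1 ht]
    simp only [sub_self, abs_zero, mul_zero, dist_self]
    constructor
    · have : 0 < r + A⁻¹ := by positivity
      linarith
    · positivity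
  have hex : ∃ N, Joined r N a b := (H a b).imp fun N h => h.1
  set N := Nat.find hex with hN
  obtain ⟨y, y0, y1, hy⟩ := Nat.find_spec hex
  have hNA : (N : ℝ) ≤ A * dist a b := by
    obtain ⟨K, hK, hK'⟩ := H a b
    exact (Nat.cast_le.2 (Nat.find_min' hex hK)).trans hK'
  have hNr : dist a b ≤ r * N := Joined.dist_le ⟨y, y0, y1, hy⟩
  have hd : 0 < dist a b := dist_pos.2 hab
  have hsub : ∀ i j, i ≤ j → j ≤ N → Joined r (j - i) (y i) (y j) := fun i j hij hj =>
    ⟨fun k => y (i + k), rfl, by simp [hij], fun k hk => hy _ (by omega)⟩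
  -- The chain is shortest, so replacing its part from `i` to `j` by the chain that `H` provides
  -- cannot save steps.
  have hlow : ∀ i j, i ≤ j → j ≤ N → ((j : ℝ) - i) ≤ A * dist (y i) (y j) := fun i j hij hj => by
    obtain ⟨K, hK, hK'⟩ := H (y i) (y j)
    have h1 := ((hsub 0 i (Nat.zero_le _) (by omega)).trans hK).trans (hsub j N hj le_rfl)
    rw [y0, y1] at h1
    have h2 := Nat.find_min' hex h1
    refine le_trans ?_ hK'
    rw [sub_le_iff_le_add]
    exact_mod_cast (by omega : j ≤ K + i)
  have hup : ∀ i j, i ≤ j → j ≤ N → dist (y i) (y j) ≤ r * (j - i) := fun i j hij hj => by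
    have := (hsub i j hij hj).dist_le
    rwa [Nat.cast_sub hij] at this
  -- The speed of the reparametrised chain, between `r⁻¹` and `A`.
  set c : ℝ := N / dist a b with hc
  have hc0 : 0 ≤ c := by positivity
  have hcA : c ≤ A := (div_le_iff₀ hd).2 hNA
  have hcr : 1 ≤ r * c := by
    rw [hc, mul_div_assoc', le_div_iff₀ hd, one_mul]
    exact hNr
  have key : ∀ s t, 0 ≤ s → s ≤ t → t ≤ dist a b →
      (r * A)⁻¹ * |s - t| - (r + A⁻¹) ≤ dist (y ⌊s * c⌋₊) (y ⌊t * c⌋₊) ∧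
      dist (y ⌊s * c⌋₊) (y ⌊t * c⌋₊) ≤ r * A * |s - t| + (r + A⁻¹) := by
    intro s t hs hst ht
    have hij : ⌊s * c⌋₊ ≤ ⌊t * c⌋₊ := Nat.floor_mono (mul_le_mul_of_nonneg_right hst hc0)
    have hj : ⌊t * c⌋₊ ≤ N := by
      refine Nat.floor_le_of_le ((mul_le_mul_of_nonneg_right ht hc0).trans (le_of_eq ?_))
      rw [hc]
      field_simp
    have h1 := hlow _ _ hij hj
    have h2 := hup _ _ hij hj
    have s1 := Nat.floor_le (mul_nonneg hs hc0)
    have s2 := Nat.lt_floor_add_one (s * c)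
    have t1 := Nat.floor_le (mul_nonneg (hs.trans hst) hc0)
    have t2 := Nat.lt_floor_add_one (t * c)
    rw [abs_sub_comm, abs_of_nonneg (sub_nonneg.2 hst)]
    have hts : 0 ≤ t - s := sub_nonneg.2 hst
    have hinv : 0 < A⁻¹ := inv_pos.2 hA
    constructor
    · have h3 : (t - s) * c - 1 ≤ A * dist (y ⌊s * c⌋₊) (y ⌊t * c⌋₊) := by linarith
      have h4 : A⁻¹ * ((t - s) * c - 1) ≤ dist (y ⌊s * c⌋₊) (y ⌊t * c⌋₊) := by
        rw [inv_mul_le_iff₀ hA]; exact h3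
      have h5 : (r * A)⁻¹ * (t - s) ≤ A⁻¹ * ((t - s) * c) := by
        rw [mul_inv, mul_comm r⁻¹, mul_assoc]
        refine mul_le_mul_of_nonneg_left ?_ hinv.le
        rw [inv_mul_le_iff₀ hr]
        nlinarith
      linarith
    · have h3 : r * ((⌊t * c⌋₊ : ℝ) - ⌊s * c⌋₊) ≤ r * ((t - s) * A + 1) := by
        refine mul_le_mul_of_nonneg_left ?_ hr.le
        nlinarith
      linarith
  refine ⟨fun s => y ⌊s * c⌋₊, by simp [y0], ?_, fun s hs t ht => ?_⟩
  · have : dist a b * c = N := by rw [hc]; field_simp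
    simp only [this, Nat.floor_natCast]
    exact y1
  · rcases le_total s t with h | h
    · exact key s t hs.1 h ht.2
    · rw [dist_comm, abs_sub_comm]
      exact key t s ht.1 h hs.2

/-! ### Induced distance against interval cardinality -/

section InducedDist

variable {X : Type u} {μ : X → X → X → X}

lemma eq_of_ncard_le_one (hμ : IsCoarseMedianAlgebra μ) {a b : X}
    (h : (interval μ a b).ncard ≤ 1) : a = b :=
  (Set.ncard_le_one (hμ.finite _ _)).1 h _ (left_mem_interval hμ.localised _ _) _
    (right_mem_interval hμ.localised hμ.symmetric _ _)

lemma inducedDist_le_ncard (hμ : IsCoarseMedianAlgebra μ) (a b : X) :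
    inducedDist μ a b ≤ (interval μ a b).ncard - 1 :=
  Nat.sInf_le ⟨1, fun i => if i = 0 then a else b, rfl, rfl, fun _ _ => hμ.finite _ _, by simp⟩

/-- Induction along a minimal chain. Links whose interval has one point join equal points and can be
dropped, so each remaining link has positive weight. -/
lemma inducedDist_induction (hμ : IsCoarseMedianAlgebra μ) (Q : ℕ → X → X → Prop)
    (h0 : ∀ a, Q 0 a a)
    (hs : ∀ s a b c, Q s a b → 2 ≤ (interval μ b c).ncard →
      Q (s + ((interval μ b c).ncard - 1)) a c) (a b : X) : Q (inducedDist μ a b) a b := by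
  obtain ⟨n, x, rfl, rfl, -, hx⟩ := Nat.sInf_mem (chainWeights_nonempty hμ a b)
  rw [inducedDist, hx]
  clear hx
  induction n with
  | zero => exact h0 _
  | succ n ih =>
    rw [Finset.sum_range_succ]
    by_cases h : (interval μ (x n) (x (n + 1))).ncard ≤ 1
    · rw [Nat.sub_eq_zero_of_le h, ← eq_of_ncard_le_one hμ h]
      exact ih
    · exact hs _ _ _ _ ih (by omega)

/-- The cardinality of an interval is bounded in terms of the induced distance. -/
lemma exists_cardLE_of_inducedDist (hμ : IsCoarseMedianAlgebra μ) (hv : BoundedValency μ) :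
    ∃ F : ℕ → ℝ≥0, Monotone F ∧ ∀ a b s, inducedDist μ a b ≤ s → CardLE (interval μ a b) (F s) := by
  obtain ⟨B, hB⟩ := exists_cardLE_interval_trans hμ hv
  -- A link of cardinality `k + 2` has weight `k + 1`. If it brings the total from `s` to `s + k +
  -- 1`, its cardinality is at most `(s + k) + 2`, so one step of the recursion, at `s + k`, covers
  -- it.
  let F : ℕ → ℝ≥0 := fun s => Nat.rec 1 (fun s r => max r (B r (s + 2))) s
  have hF : Monotone F := monotone_nat_of_le_succ fun s => le_max_left _ _
  refine ⟨F, hF, fun a b s hs => CardLE.mono ?_ subset_rfl (hF hs)⟩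
  clear hs s
  refine inducedDist_induction hμ (fun s a b => CardLE (interval μ a b) (F s))
    (fun a => cardLE_interval_self hμ.localised hμ.symmetric a) (fun s a b c ih h => ?_) a b
  obtain ⟨k, hk⟩ := Nat.exists_eq_add_of_le h
  have h1 : s + ((interval μ b c).ncard - 1) = (s + k) + 1 := by omega
  rw [h1]
  refine (hB a b c (F (s + k)) (((s + k : ℕ) : ℝ≥0) + 2)
    (ih.mono subset_rfl (hF (Nat.le_add_right s k))) ⟨hμ.finite _ _, ?_⟩).mono subset_rfl (le_max_right _ _)
  rw [hk]
  exact_mod_cast (by omega : 2 + k ≤ s + k + 2)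

end InducedDist

/-! ### The induced metric space of a coarse median algebra -/

namespace Algebra

variable (A : Algebra.{u})

lemma dist_metrized (a b : A.Metrized) : dist a b = inducedDist A.med a b := rfl

lemma nndist_metrized (a b : A.Metrized) : nndist a b = (inducedDist A.med a b : ℝ≥0) := by
  rw [← NNReal.coe_inj, coe_nndist, dist_metrized]
  simp

lemma nndist_metrized_le {a b : A.Metrized} {R : ℝ≥0} (h : CardLE (interval A.med a b) R) :
    nndist a b ≤ R := by
  rw [nndist_metrized]
  refine le_trans (Nat.cast_le.2 ?_) h.2
  exact (inducedDist_le_ncard A.isCoarseMedianAlgebra a b).trans (Nat.sub_le _ _)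

lemma dist_metrized_le {a b : A.Metrized} {R : ℝ≥0} (h : CardLE (interval A.med a b) R) :
    dist a b ≤ R := by
  rw [← coe_nndist]
  exact NNReal.coe_le_coe.2 (A.nndist_metrized_le h)

lemma exists_monotone_cardLE :
    ∃ φ : ℝ≥0 → ℝ≥0, Monotone φ ∧ ∀ (a b : A.Metrized) (R : ℝ≥0), nndist a b ≤ R →
      CardLE (interval A.med a b) (φ R) := by
  obtain ⟨F, hF, h⟩ := exists_cardLE_of_inducedDist A.isCoarseMedianAlgebra A.boundedValency
  refine ⟨fun R => F ⌊R⌋₊, fun R S hRS => hF (Nat.floor_mono hRS), fun a b R hR => h _ _ _ ?_⟩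
  rw [nndist_metrized] at hR
  exact Nat.le_floor hR

lemma isCoarseMedianSpace_metrized : IsCoarseMedianSpace A.metrizedMed where
  localised := A.isCoarseMedianAlgebra.localised
  symmetric := A.isCoarseMedianAlgebra.symmetric
  bornologous := by
    obtain ⟨φ, hφ, h⟩ := A.exists_monotone_cardLE
    obtain ⟨M, hM⟩ := exists_cardLE_interval_med A.isCoarseMedianAlgebra A.boundedValency
    exact ⟨fun R => φ R * M, fun R S hRS => mul_le_mul_left (hφ hRS) M, fun a a' b c =>
      A.nndist_metrized_le (hM a a' b c _ (h a a' _ le_rfl))⟩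
  four_point := by
    obtain ⟨K, hK⟩ := A.isCoarseMedianAlgebra.five_point
    have hs := A.isCoarseMedianAlgebra.symmetric
    have key : ∀ a b c d,
        CardLE (interval A.med (A.med (A.med a b c) b d) (A.med a b (A.med c b d))) K := by
      intro a b c d
      have := hK a b c b d
      rwa [hs.rotate a b b, A.isCoarseMedianAlgebra.localised, interval_comm hs] at this
    exact ⟨K + 1, by positivity, fun a b c d =>
      (A.dist_metrized_le (key a b c d)).trans (by simp)⟩

lemma boundedGeometry_metrized : BoundedGeometry A.Metrized := by
  obtain ⟨φ, hφ, h⟩ := A.exists_monotone_cardLE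
  obtain ⟨ψ, hψ⟩ := A.boundedValency
  intro r hr
  refine ⟨⌊ψ (φ r.toNNReal)⌋₊, fun x => ?_⟩
  have : CardLE (Metric.closedBall x r) (ψ (φ r.toNNReal)) := by
    refine (hψ (φ r.toNNReal) x).mono (fun (y : A.Metrized) hy => h x y _ ?_) le_rfl
    rw [← NNReal.coe_le_coe, coe_nndist, Real.coe_toNNReal _ hr.le, dist_comm]
    exact hy
  exact ⟨this.1, Nat.le_floor this.2⟩

lemma quasiGeodesicSpace_metrized (hq : QuasiGeodesicAlgebra A.med) :
    QuasiGeodesicSpace A.Metrized := by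
  have hμ := A.isCoarseMedianAlgebra
  obtain ⟨L, C, hL, hC, H⟩ := hq
  -- The factor 2 comes from `k ≤ 2 * (k - 1)` for a link of cardinality `k ≥ 2`, whose weight is `k
  -- - 1`.
  refine quasiGeodesicSpace_of_joined (A := 2 * L) (r := C + 1) (by positivity) (by positivity)
    fun a b => ?_
  rw [dist_metrized]
  refine inducedDist_induction (X := A.Metrized) hμ (fun s (a b : A.Metrized) => ∃ N : ℕ,
    Joined ((C : ℝ) + 1) N a b ∧ (N : ℝ) ≤ 2 * L * (s : ℝ)) (fun a => ⟨0, Joined.refl _ a, by simp⟩)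
    (fun s a b c ⟨N, hN, hNs⟩ h => ?_) a b
  obtain ⟨n, y, y0, y1, hy, hn⟩ := H b c
  refine ⟨N + n, hN.trans ⟨y, y0, y1, fun j hj => ?_⟩, ?_⟩
  · exact A.dist_metrized_le (hy j hj)
  · have h1 : (n : ℝ) ≤ L * (interval A.med b c).ncard := by
      exact_mod_cast NNReal.coe_le_coe.2 (hn (hμ.finite _ _))
    have aux : ∀ k : ℕ, 2 ≤ k → (n : ℝ) ≤ L * k →
        ((N + n : ℕ) : ℝ) ≤ 2 * L * ((s + (k - 1) : ℕ) : ℝ) := fun k hk hnk => by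
      have h2 : (2 : ℝ) ≤ k := by exact_mod_cast hk
      have h3 : (0 : ℝ) < L := hL
      rw [Nat.cast_add, Nat.cast_add, Nat.cast_sub (by omega)]
      push_cast
      nlinarith [mul_nonneg h3.le (sub_nonneg.2 h2)]
    exact aux _ h h1

end Algebra

/-! ### Algebra maps as coarse median morphisms -/

section CoarseMaps

variable {X Y : Type u} [MetricSpace X] [MetricSpace Y]

/-- Adding the identity to any monotone control function makes it proper. -/
lemma exists_proper_control {f : X → Y} {φ : ℝ≥0 → ℝ≥0} (hφ : Monotone φ)
    (h : ∀ x x', nndist (f x) (f x') ≤ φ (nndist x x')) :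
    ∃ ρ : ℝ≥0 → ℝ≥0, Monotone ρ ∧ Tendsto ρ atTop atTop ∧
      ∀ x x', nndist (f x) (f x') ≤ ρ (nndist x x') :=
  ⟨fun R => φ R + R, fun _ _ hRS => add_le_add (hφ hRS) hRS,
    tendsto_atTop_mono (fun _ => le_add_self) tendsto_id,
    fun x x' => (h x x').trans le_self_add⟩

lemma isCoarseMap_of_controlled {f : X → Y} {φ ψ : ℝ≥0 → ℝ≥0} (hφ : Monotone φ) (hψ : Monotone ψ)
    (h : ∀ x x', nndist (f x) (f x') ≤ φ (nndist x x'))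
    (h' : ∀ x x', nndist x x' ≤ ψ (nndist (f x) (f x'))) : IsCoarseMap f where
  bornologous := exists_proper_control hφ h
  proper B hB := by
    obtain ⟨C, hC⟩ := Metric.isBounded_iff_nndist.1 hB
    exact Metric.isBounded_iff_nndist.2 ⟨ψ C, fun x hx y hy => (h' x y).trans (hψ (hC hx hy))⟩

end CoarseMaps

lemma IsAlgebraMap.isCoarseMedianMorphism {A B : Algebra.{u}} {f : A.Metrized → B.Metrized}
    (hf : IsAlgebraMap A.med B.med f) :
    IsCoarseMedianMorphism A.metrizedMed B.metrizedMed f where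
  coarse :=
    { bornologous := by
        obtain ⟨φ, hφ, h⟩ := A.exists_monotone_cardLE
        obtain ⟨ρ, hρ, hfρ⟩ := hf.controlled
        exact exists_proper_control (φ := fun R => ρ (φ R)) (fun R S hRS => hρ (hφ hRS))
          fun x x' => B.nndist_metrized_le ⟨B.isCoarseMedianAlgebra.finite _ _,
            (hfρ x x').trans (hρ (h x x' _ le_rfl).2)⟩
      -- Bounded sets are finite by bounded geometry, so a finite-to-one map has finite, hence
      -- bounded, preimages.
      proper := fun S hS => by
        rcases S.eq_empty_or_nonempty with rfl | ⟨x, -⟩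
        · simp
        · obtain ⟨r, hr⟩ := hS.subset_closedBall x
          obtain ⟨N, hN⟩ := B.boundedGeometry_metrized (max 1 r) (by positivity)
          have hfin : S.Finite := (hN x).1.subset
            (hr.trans (Metric.closedBall_subset_closedBall (le_max_right _ _)))
          have hpre : (f ⁻¹' S).Finite := hfin.preimage' fun y _ => hf.finite_to_one y
          exact hpre.isBounded }
  quasi := by
    obtain ⟨C, hC⟩ := hf.quasi
    exact ⟨C + 1, by positivity, fun a b c => (B.dist_metrized_le (hC a b c)).trans (by simp)⟩

lemma AlgClose.close {W : Type u} {B : Algebra.{u}} {f g : W → B.Metrized}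
    (h : AlgClose B.med f g) : Close f g := by
  obtain ⟨D, hD⟩ := h
  exact ⟨D, fun x => B.dist_metrized_le (hD x)⟩

theorem inducedMetricWellDefined : InducedMetricWellDefined.{u} where
  isSpace A := A.obj.isCoarseMedianSpace_metrized
  boundedGeometry A := A.obj.boundedGeometry_metrized
  quasiGeodesic A := A.obj.quasiGeodesicSpace_metrized A.property
  map _ _ _ hf := hf.isCoarseMedianMorphism
  close _ _ _ _ _ _ h := h.close

end AlgebraToSpace

/-! ### The equivalence of categories -/

section Equivalence

/-- The space with the metric induced by its median. -/
noncomputable abbrev QGSpace.remetrized (X : QGSpace.{u}) : QGSpace.{u} :=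
  (forgetfulFunctor forgetfulWellDefined ⋙ inducedMetricFunctor inducedMetricWellDefined).obj X

/-- Both metrics are controlled by, and control, the cardinality of intervals. -/
lemma QGSpace.exists_comparison (X : QGSpace.{u}) :
    ∃ φ ψ : ℝ≥0 → ℝ≥0, Monotone φ ∧ Monotone ψ ∧ ∀ a b : X.obj.carrier,
      nndist (α := X.remetrized.obj.carrier) a b ≤ φ (nndist a b) ∧
      nndist a b ≤ ψ (nndist (α := X.remetrized.obj.carrier) a b) := by
  let A := ((forgetfulFunctor forgetfulWellDefined).obj X).obj
  have hX := X.obj.isCoarseMedianSpace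
  obtain ⟨φ, hφ, h⟩ := exists_monotone_cardLE_interval hX X.property.1
  obtain ⟨r, -, hr⟩ := hX.exists_dist_le_of_cardLE X.property.1 X.property.2
  obtain ⟨ψ, hψ, h'⟩ := A.exists_monotone_cardLE
  exact ⟨φ, fun R => r * ψ R, hφ, fun R S hRS => mul_le_mul_right (hψ hRS) r, fun a b =>
    ⟨A.nndist_metrized_le (h a b _ le_rfl), hr a b _ (h' a b _ le_rfl).2⟩⟩

lemma QGSpace.isCoarseMedianMorphism_remetrize (X : QGSpace.{u}) :
    IsCoarseMedianMorphism X.obj.med X.remetrized.obj.med (id : X.obj.carrier → X.obj.carrier) := by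
  obtain ⟨φ, ψ, hφ, hψ, h⟩ := X.exists_comparison
  exact ⟨isCoarseMap_of_controlled hφ hψ (fun a b => (h a b).1) fun a b => (h a b).2,
    1, one_pos, fun a b c => (dist_self _).trans_le zero_le_one⟩

lemma QGSpace.isCoarseMedianMorphism_unremetrize (X : QGSpace.{u}) :
    IsCoarseMedianMorphism X.remetrized.obj.med X.obj.med (id : X.obj.carrier → X.obj.carrier) := by
  obtain ⟨φ, ψ, hφ, hψ, h⟩ := X.exists_comparison
  exact ⟨isCoarseMap_of_controlled hψ hφ (fun a b => (h a b).2) fun a b => (h a b).1,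
    1, one_pos, fun a b c => (dist_self _).trans_le zero_le_one⟩

/-- A space is isomorphic to its remetrization. -/
noncomputable def QGSpace.remetrizeIso (X : QGSpace.{u}) : X ≅ X.remetrized where
  hom := ObjectProperty.homMk (Quotient.mk (Space.homSetoid X.obj X.remetrized.obj)
    ⟨id, X.isCoarseMedianMorphism_remetrize⟩)
  inv := ObjectProperty.homMk (Quotient.mk (Space.homSetoid X.remetrized.obj X.obj)
    ⟨id, X.isCoarseMedianMorphism_unremetrize⟩)
  hom_inv_id := rfl
  inv_hom_id := rfl

/-- The forgetful and the induced metric functor form an equivalence of categories. -/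
noncomputable def spaceAlgebraEquivalence : QGSpace.{u} ≌ QGAlgebra.{u} :=
  CategoryTheory.Equivalence.mk (forgetfulFunctor forgetfulWellDefined)
    (inducedMetricFunctor inducedMetricWellDefined)
    (NatIso.ofComponents QGSpace.remetrizeIso fun {X Y} F => by
      obtain ⟨F⟩ := F
      induction F using Quotient.inductionOn
      rfl)
    -- Forgetting the induced metric returns the original algebra, so the counit is the identity.
    (NatIso.ofComponents (fun A => Iso.refl A) fun {A B} F => by
      obtain ⟨F⟩ := F
      induction F using Quotient.inductionOn
      rfl)

end Equivalence

end CoarseMedian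

theorem mainTheorem12 :
    ∃ (hF : CoarseMedian.ForgetfulWellDefined.{u})
      (hG : CoarseMedian.InducedMetricWellDefined.{u}),
      (∃ e : CoarseMedian.QGSpace.{u} ≌ CoarseMedian.QGAlgebra.{u},
        e.functor = CoarseMedian.forgetfulFunctor hF ∧
        e.inverse = CoarseMedian.inducedMetricFunctor hG) ∧
      (∀ (X : CoarseMedian.QGSpace.{u}) (n : ℕ),
        CoarseMedian.SpaceRankLE X.obj.med n ↔
          CoarseMedian.AlgebraRankLE ((CoarseMedian.forgetfulFunctor hF).obj X).obj.med n) ∧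
      (∀ (A : CoarseMedian.QGAlgebra.{u}) (n : ℕ),
        CoarseMedian.AlgebraRankLE A.obj.med n ↔
          CoarseMedian.SpaceRankLE ((CoarseMedian.inducedMetricFunctor hG).obj A).obj.med n) :=
  ⟨CoarseMedian.forgetfulWellDefined, CoarseMedian.inducedMetricWellDefined,
    ⟨CoarseMedian.spaceAlgebraEquivalence, rfl, rfl⟩,
    fun X n => CoarseMedian.spaceRankLE_iff_algebraRankLE X.obj.isCoarseMedianSpace
      X.property.1 X.property.2 n,
    fun A n => (CoarseMedian.spaceRankLE_iff_algebraRankLE A.obj.isCoarseMedianSpace_metrized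
      A.obj.boundedGeometry_metrized (A.obj.quasiGeodesicSpace_metrized A.property) n).symm⟩
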